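/- Let $E_0,E_1,E_2$ be complex Banach spaces and let $\bullet:E_0\times E_1\to E_2$ be a multiplication, i.e. a continuous bilinear map of norm at most $1$. For a complex Banach space $E$ let $\mathcal S'(\mathbb R^d,E)=\mathcal L(\mathcal S(\mathbb R^d),E)$ be the space of $E$-valued temperate distributions, let $\langle x\rangle=(1+|x|^2)^{1/2}$, and for a non-zero window $g\in\mathcal S(\mathbb R^d)$ let $V_gf(x,\xi)=\langle f,M_\xi T_xg\rangle$, where $M_\xi T_x g(y)=e^{2\pi i y\cdot\xi}g(y-x)$ and the bracket is linear in $f$ and antilinear in the test function, be the short-time Fourier transform of $f\in\mathcal S'(\mathbb R^d,E)$. For $1\le p,q\le\infty$ and $r,s\in\mathbb R$ put \[ \|f\|_{M^{p,q}_{r,s}(E)}=\Big(\int_{\mathbb R^d}\Big(\int_{\mathbb R^d}|V_gf(x,\xi)|_E^p\langle x\rangle^{rp}\,dx\Big)^{q/p}\langle\xi\rangle^{sq}\,d\xi\Big)^{1/q}, \] \[ \|f\|_{W^{p,q}_{r,s}(E)}=\Big(\int_{\mathbb R^d}\Big(\int_{\mathbb R^d}|V_gf(x,\xi)|_E^p\langle\xi\rangle^{rp}\,d\xi\Big)^{q/p}\langle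 x\rangle^{sq}\,dx\Big)^{1/q}, \] with the usual modification if $p=\infty$ or $q=\infty$; $M^{p,q}_{r,s}(\mathbb R^d,E)$ and $W^{p,q}_{r,s}(\mathbb R^d,E)$ consist of the $f\in\mathcal S'(\mathbb R^d,E)$ for which the respective quantity is finite for some non-zero $g\in\mathcal S(\mathbb R^d)$. For $\mu\in\mathcal S'(\mathbb R^d,E_0)$ the Fourier multiplier with symbol $\mu$ is the linear map $\mu(D)f=\mathcal F^{-1}\mu*_\bullet f\in\mathcal S'(\mathbb R^d,E_2)$, whose domain consists of all $f\in\mathcal S'(\mathbb R^d,E_1)$ for which this convolution exists. Here $h=u*_\bullet v$ means that for all $\varphi,\psi\in\mathcal S(\mathbb R^d)$ and all $x\in\mathbb R^d$ the integral $\int_{\mathbb R^d}(u*\varphi)(x-y)\bullet(v*\psi)(y)\,dy$ converges absolutely and equals $(h*(\varphi*\psi))(x)$; such an $h\in\mathcal S'(\mathbb R^d,E_2)$ is unique. Let $1\le p,q\le\infty$, let $r,s,\delta\in\mathbb R$, and let $\mu\in W^{1,\infty}_{|r|,\delta}(\mathbb R^d,E_0)$. Then $M^{p,q}_{r,s}(\mathbb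 R^d,E_1)$ is contained in the domain of $\mu(D)$, and $\mu(D)$ is bounded from $M^{p,q}_{r,s}(\mathbb R^d,E_1)$ to $M^{p,q}_{r,s+\delta}(\mathbb R^d,E_2)$, with \[ \|\mu(D)f\|_{M^{p,q}_{r,s+\delta}(E_2)}\le C\,\|\mu\|_{W^{1,\infty}_{|r|,\delta}(E_0)}\,\|f\|_{M^{p,q}_{r,s}(E_1)},\qquad f\in M^{p,q}_{r,s}(\mathbb R^d,E_1). \] The three norms may be taken with respect to arbitrary non-zero windows $g_2,g_0,g_1\in\mathcal S(\mathbb R^d)$ respectively, and the constant $C$ depends only on $d,p,q,r,s,\delta$ and these windows, not on the spaces $E_j$, the multiplication, $\mu$ or $f$. -/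

import Mathlib

open MeasureTheory FourierTransform
open scoped SchwartzMap ENNReal NNReal

noncomputable section

namespace TimeFrequency

/-- The Euclidean space `ℝᵈ`. -/
abbrev Rd (d : ℕ) : Type := EuclideanSpace ℝ (Fin d)

/-- The weight `⟨x⟩ = (1 + |x|²)^{1/2}`. -/
def bracket {d : ℕ} (x : Rd d) : ℝ := Real.sqrt (1 + ‖x‖ ^ 2)

/-! ### Time-frequency shifts of test functions -/

/-- The character `y ↦ e^{-2πi y·ξ}`. -/
def character {d : ℕ} (ξ : Rd d) (y : Rd d) : ℂ :=
  Complex.exp (-(2 * Real.pi * Complex.I) * (inner ℝ y ξ : ℝ))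

lemma hasTemperateGrowth_cexp (c : ℂ) (hc : c.re = 0) :
    Function.HasTemperateGrowth (fun t : ℝ => Complex.exp (c * t)) := by
  have hd : ∀ n : ℕ, iteratedDeriv n (fun t : ℝ => Complex.exp (c * t)) =
      fun t : ℝ => c ^ n * Complex.exp (c * t) := by
    intro n
    induction n with
    | zero => simp
    | succ n ih =>
      rw [iteratedDeriv_succ, ih]
      ext t
      have h1 : HasDerivAt (fun t : ℝ => c * (t : ℂ)) c t := by
        simpa using (Complex.ofRealCLM.hasDerivAt (x := t)).const_mul c
      rw [(h1.cexp.const_mul (c ^ n)).deriv]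
      ring
  refine ⟨(contDiff_const.mul Complex.ofRealCLM.contDiff).cexp, fun n => ⟨0, ‖c‖ ^ n, fun t => ?_⟩⟩
  rw [norm_iteratedFDeriv_eq_norm_iteratedDeriv, hd]
  simp [Complex.norm_exp, hc]

lemma hasTemperateGrowth_character {d : ℕ} (ξ : Rd d) :
    Function.HasTemperateGrowth (character ξ) :=
  (hasTemperateGrowth_cexp (-(2 * Real.pi * Complex.I)) (by simp)).comp
    (Function.hasTemperateGrowth_inner_left ξ)

/-- The Schwartz function `y ↦ e^{-2πi y·ξ} conj (g (y - x))`, the complex conjugate of the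
time-frequency shift `M_ξ T_x g`. -/
def conjShift {d : ℕ} (g : 𝓢(Rd d, ℂ)) (x ξ : Rd d) : 𝓢(Rd d, ℂ) :=
  SchwartzMap.smulLeftCLM ℂ (character ξ)
    (SchwartzMap.postcompCLM (𝕜 := ℝ) (Complex.conjCLE : ℂ →L[ℝ] ℂ)
      (g.compSubConstCLM ℝ x))

lemma conjShift_apply {d : ℕ} (g : 𝓢(Rd d, ℂ)) (x ξ y : Rd d) :
    conjShift g x ξ y =
      Complex.exp (-(2 * Real.pi * Complex.I) * (inner ℝ y ξ : ℝ)) *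
        (starRingEnd ℂ) (g (y - x)) := by
  simp [conjShift, SchwartzMap.smulLeftCLM_apply_apply (hasTemperateGrowth_character ξ),
    character]

/-- The operator `φ ↦ φ (x - ·)` on Schwartz functions. -/
def reflectAt {d : ℕ} (x : Rd d) : 𝓢(Rd d, ℂ) →L[ℂ] 𝓢(Rd d, ℂ) :=
  SchwartzMap.compCLMOfAntilipschitz (g := fun y : Rd d => x - y) (K := 1) ℂ (by fun_prop)
    (fun _ _ => by simp)

lemma reflectAt_apply {d : ℕ} (x y : Rd d) (φ : 𝓢(Rd d, ℂ)) :
    reflectAt x φ y = φ (x - y) := rfl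

section Spaces

variable {d : ℕ} {E : Type*} [NormedAddCommGroup E] [NormedSpace ℂ E]

/-! ### Short-time Fourier transform, modulation spaces, Wiener amalgam spaces

An `E`-valued tempered distribution is a continuous linear map `𝓢(ℝᵈ) → E`; the pairing of `f`
with `g` that is antilinear in `g` is `f (conj g)`. -/

/-- The short-time Fourier transform `V_g f (x, ξ) = ⟨f, M_ξ T_x g⟩`. -/
def stft (g : 𝓢(Rd d, ℂ)) (f : 𝓢'(Rd d, E)) (x ξ : Rd d) : E := f (conjShift g x ξ)

/-- The norm of `M^{p,q}_{r,s}` with respect to the window `g`: the `L^p_r` norm in `x`,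
followed by the `L^q_s` norm in `ξ`. -/
def modulationNorm (g : 𝓢(Rd d, ℂ)) (p q : ℝ≥0∞) (r s : ℝ) (f : 𝓢'(Rd d, E)) : ℝ≥0∞ :=
  eLpNorm (fun ξ : Rd d =>
    eLpNorm (fun x : Rd d => bracket x ^ r * ‖stft g f x ξ‖) p volume *
      ENNReal.ofReal (bracket ξ ^ s)) q volume

/-- The norm of `W^{p,q}_{r,s}` with respect to the window `g`: the `L^p_r` norm in `ξ`,
followed by the `L^q_s` norm in `x`. -/
def amalgamNorm (g : 𝓢(Rd d, ℂ)) (p q : ℝ≥0∞) (r s : ℝ) (f : 𝓢'(Rd d, E)) : ℝ≥0∞ :=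
  eLpNorm (fun x : Rd d =>
    eLpNorm (fun ξ : Rd d => bracket ξ ^ r * ‖stft g f x ξ‖) p volume *
      ENNReal.ofReal (bracket x ^ s)) q volume

/-- Membership in the modulation space `M^{p,q}_{r,s}(ℝᵈ, E)`. -/
def MemModulation (p q : ℝ≥0∞) (r s : ℝ) (f : 𝓢'(Rd d, E)) : Prop :=
  ∃ g : 𝓢(Rd d, ℂ), g ≠ 0 ∧ modulationNorm g p q r s f < ∞

/-- Membership in the Wiener amalgam space `W^{p,q}_{r,s}(ℝᵈ, E)`. -/
def MemAmalgam (p q : ℝ≥0∞) (r s : ℝ) (f : 𝓢'(Rd d, E)) : Prop :=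
  ∃ g : 𝓢(Rd d, ℂ), g ≠ 0 ∧ amalgamNorm g p q r s f < ∞

/-- The (smooth) function `f * φ` for a tempered distribution `f` and a Schwartz function `φ`. -/
def smoothing (f : 𝓢'(Rd d, E)) (φ : 𝓢(Rd d, ℂ)) (x : Rd d) : E := f (reflectAt x φ)

end Spaces

/-- The convolution of two scalar Schwartz functions. -/
def schwartzConv {d : ℕ} (φ ψ : 𝓢(Rd d, ℂ)) : 𝓢(Rd d, ℂ) :=
  SchwartzMap.convolution (ContinuousLinearMap.mul ℂ ℂ) φ ψ

lemma schwartzConv_apply {d : ℕ} (φ ψ : 𝓢(Rd d, ℂ)) (x : Rd d) :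
    schwartzConv φ ψ x = ∫ y, φ y * ψ (x - y) := by
  rw [schwartzConv, SchwartzMap.convolution_apply]
  rfl

/-! ### Convolution of vector-valued tempered distributions -/

section Convolution

variable {d : ℕ} {E₀ E₁ E₂ : Type*}
  [NormedAddCommGroup E₀] [NormedSpace ℂ E₀]
  [NormedAddCommGroup E₁] [NormedSpace ℂ E₁]
  [NormedAddCommGroup E₂] [NormedSpace ℂ E₂]

/-- `h` is the convolution of the tempered distributions `u` and `v` with respect to the bilinear
map `B`: for all Schwartz functions `φ, ψ`, the convolution of the smooth functions `u * φ` and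
`v * ψ` exists as an absolutely convergent integral, and `(u * φ) * (v * ψ) = h * (φ * ψ)`.
This is the classical (Chevalley) definition of the convolution of two tempered distributions. -/
def IsConvolution (B : E₀ →L[ℂ] E₁ →L[ℂ] E₂)
    (u : 𝓢'(Rd d, E₀)) (v : 𝓢'(Rd d, E₁)) (h : 𝓢'(Rd d, E₂)) : Prop :=
  ∀ (φ ψ : 𝓢(Rd d, ℂ)) (x : Rd d),
    Integrable (fun y : Rd d => B (smoothing u φ (x - y)) (smoothing v ψ y)) ∧
    ∫ y : Rd d, B (smoothing u φ (x - y)) (smoothing v ψ y) = smoothing h (schwartzConv φ ψ) x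

/-- The set of pairs `(v, h)` such that `h` is the convolution of `u` and `v`. -/
def convolutionGraph (B : E₀ →L[ℂ] E₁ →L[ℂ] E₂) (u : 𝓢'(Rd d, E₀)) :
    Submodule ℂ (𝓢'(Rd d, E₁) × 𝓢'(Rd d, E₂)) where
  carrier := {z | IsConvolution B u z.1 z.2}
  zero_mem' := by
    intro φ ψ x
    simp [smoothing]
  add_mem' := by
    intro a b ha hb φ ψ x
    have h1 := ha φ ψ x
    have h2 := hb φ ψ x
    have e : (fun y : Rd d => B (smoothing u φ (x - y)) (smoothing (a + b).1 ψ y)) =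
        fun y => B (smoothing u φ (x - y)) (smoothing a.1 ψ y) +
          B (smoothing u φ (x - y)) (smoothing b.1 ψ y) := by
      ext y; simp [smoothing]
    rw [e]
    refine ⟨h1.1.add h2.1, ?_⟩
    rw [integral_add h1.1 h2.1, h1.2, h2.2]
    simp [smoothing]
  smul_mem' := by
    intro c a ha φ ψ x
    have h1 := ha φ ψ x
    have e : (fun y : Rd d => B (smoothing u φ (x - y)) (smoothing (c • a).1 ψ y)) =
        fun y => c • B (smoothing u φ (x - y)) (smoothing a.1 ψ y) := by
      ext y; simp [smoothing]
    rw [e]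
    refine ⟨h1.1.smul c, ?_⟩
    rw [integral_smul, h1.2]
    simp [smoothing]

/-- The Fourier multiplier `μ(D) f = 𝓕⁻¹ μ * f`, as a linear map whose domain consists of all
`f` for which the convolution exists. -/
def fourierMultiplier (B : E₀ →L[ℂ] E₁ →L[ℂ] E₂) (μ : 𝓢'(Rd d, E₀)) :
    𝓢'(Rd d, E₁) →ₗ.[ℂ] 𝓢'(Rd d, E₂) :=
  (convolutionGraph B (𝓕⁻ μ)).toLinearPMap

/-! The convolution is unique when it exists, so that the linear map above is well defined. -/

/-- The cut-off functions `χ (c x)`, `χ 0 = 1`, act on Schwartz functions as an approximate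
identity when `c → 0`. -/
lemma seminorm_cutoff_le (χ θ : 𝓢(Rd d, ℂ)) (hχ : χ 0 = 1) (k l : ℕ) :
    ∃ M : ℝ, ∀ c : ℝ, 0 < c → c ≤ 1 → ∀ w : 𝓢(Rd d, ℂ),
      (∀ x, w x = (χ (c • x) - 1) * θ x) → SchwartzMap.seminorm ℂ k l w ≤ c * M := by
  let P : ℕ → ℝ := fun i => SchwartzMap.seminorm ℂ 0 i χ + SchwartzMap.seminorm ℂ 0 1 χ
  let M : ℝ := ∑ i ∈ Finset.range (l + 1), (l.choose i : ℝ) * P i *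
    (SchwartzMap.seminorm ℂ k (l - i) θ + SchwartzMap.seminorm ℂ (k + 1) (l - i) θ)
  have hP : ∀ i, 0 ≤ P i := fun i => add_nonneg (apply_nonneg _ _) (apply_nonneg _ _)
  have hM : 0 ≤ M := Finset.sum_nonneg fun i _ => mul_nonneg (mul_nonneg (by positivity) (hP i))
    (add_nonneg (apply_nonneg _ _) (apply_nonneg _ _))
  refine ⟨M, fun c hc hc1 w hw => ?_⟩
  have hχs : ContDiff ℝ (⊤ : ℕ∞) χ := χ.smooth ⊤
  have hWs : ContDiff ℝ (⊤ : ℕ∞) (fun x : Rd d => χ (c • x) - 1) :=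
    (hχs.comp (contDiff_const_smul c)).sub contDiff_const
  have hW : ∀ i x, ‖iteratedFDeriv ℝ i (fun x : Rd d => χ (c • x) - 1) x‖ ≤
      c * (P i * (1 + ‖x‖)) := by
    intro i x
    rcases Nat.eq_zero_or_pos i with rfl | hi
    · rw [norm_iteratedFDeriv_zero]
      have hlip : ‖χ (c • x) - χ 0‖ ≤ SchwartzMap.seminorm ℂ 0 1 χ * ‖c • x - 0‖ := by
        apply Convex.norm_image_sub_le_of_norm_fderiv_le (𝕜 := ℝ) (s := Set.univ)
          (fun y _ => χ.differentiableAt) _ convex_univ (Set.mem_univ _) (Set.mem_univ _)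
        intro y _
        have := SchwartzMap.le_seminorm ℂ 0 1 χ y
        simpa [norm_iteratedFDeriv_one] using this
      rw [hχ, sub_zero, norm_smul, Real.norm_of_nonneg hc.le] at hlip
      have h0 : SchwartzMap.seminorm ℂ 0 1 χ ≤ P 0 := le_add_of_nonneg_left (apply_nonneg _ _)
      calc _ ≤ SchwartzMap.seminorm ℂ 0 1 χ * (c * ‖x‖) := hlip
        _ ≤ P 0 * (c * (1 + ‖x‖)) := by
          apply mul_le_mul h0 _ (by positivity) (hP 0)
          gcongr; linarith
        _ = _ := by ring
    · have e : iteratedFDeriv ℝ i (fun x : Rd d => χ (c • x) - 1) x =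
          c ^ i • iteratedFDeriv ℝ i χ (c • x) := by
        have h1 : (fun x : Rd d => χ (c • x) - 1) =
            (fun x : Rd d => χ (c • x)) - fun _ => (1 : ℂ) := rfl
        have h2 : ContDiffAt ℝ i (fun x : Rd d => χ (c • x)) x :=
          ((hχs.comp (contDiff_const_smul c)).of_le (mod_cast le_top)).contDiffAt
        rw [h1, iteratedFDeriv_sub_apply h2 contDiffAt_const,
          iteratedFDeriv_const_of_ne hi.ne',
          iteratedFDeriv_comp_const_smul (i := i) c (hχs.of_le (mod_cast le_top))]
        simp
      rw [e, norm_smul, norm_pow, Real.norm_of_nonneg hc.le]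
      have h2 := SchwartzMap.le_seminorm ℂ 0 i χ (c • x)
      rw [pow_zero, one_mul] at h2
      have h3 : c ^ i ≤ c := pow_le_of_le_one hc.le hc1 hi.ne'
      have h4 : SchwartzMap.seminorm ℂ 0 i χ ≤ P i := le_add_of_nonneg_right (apply_nonneg _ _)
      apply mul_le_mul h3 _ (norm_nonneg _) hc.le
      calc _ ≤ P i * 1 := by linarith
        _ ≤ _ := mul_le_mul_of_nonneg_left (by linarith [norm_nonneg x]) (hP i)
  refine SchwartzMap.seminorm_le_bound ℂ k l w (mul_nonneg hc.le hM) fun x => ?_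
  have ew : (w : Rd d → ℂ) = fun x => (χ (c • x) - 1) * θ x := funext hw
  rw [ew]
  have hmul := norm_iteratedFDeriv_mul_le (n := l) hWs (θ.smooth ⊤) x (mod_cast le_top)
  calc _ ≤ ‖x‖ ^ k * ∑ i ∈ Finset.range (l + 1), (l.choose i : ℝ) *
        ‖iteratedFDeriv ℝ i (fun x : Rd d => χ (c • x) - 1) x‖ *
          ‖iteratedFDeriv ℝ (l - i) θ x‖ := by gcongr
    _ ≤ c * M := by
      rw [Finset.mul_sum, Finset.mul_sum]
      refine Finset.sum_le_sum fun i _ => ?_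
      have h5 := SchwartzMap.le_seminorm ℂ k (l - i) θ x
      have h6 := SchwartzMap.le_seminorm ℂ (k + 1) (l - i) θ x
      calc _ ≤ ‖x‖ ^ k * ((l.choose i : ℝ) * (c * (P i * (1 + ‖x‖))) *
            ‖iteratedFDeriv ℝ (l - i) θ x‖) := by
            gcongr; exact hW i x
        _ = c * ((l.choose i : ℝ) * P i * (‖x‖ ^ k * ‖iteratedFDeriv ℝ (l - i) θ x‖ +
            ‖x‖ ^ (k + 1) * ‖iteratedFDeriv ℝ (l - i) θ x‖)) := by ring
        _ ≤ _ := by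
            have := hP i
            gcongr

/-- A continuous linear map on Schwartz functions that vanishes on all products vanishes. -/
lemma eq_zero_of_forall_pairing (L : 𝓢(Rd d, ℂ) →L[ℂ] E₂)
    (hL : ∀ a b : 𝓢(Rd d, ℂ), L (SchwartzMap.pairing (ContinuousLinearMap.mul ℂ ℂ) a b) = 0)
    (θ : 𝓢(Rd d, ℂ)) : L θ = 0 := by
  obtain ⟨χ, hχ⟩ : ∃ χ : 𝓢(Rd d, ℂ), χ 0 = 1 := by
    let b : ContDiffBump (0 : Rd d) := default
    have h1 : HasCompactSupport (Complex.ofRealCLM ∘ b) := b.hasCompactSupport.comp_left rfl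
    have h2 : ContDiff ℝ (⊤ : ℕ∞) (Complex.ofRealCLM ∘ b) :=
      Complex.ofRealCLM.contDiff.comp b.contDiff
    refine ⟨h1.toSchwartzMap h2, ?_⟩
    have h3 : b 0 = 1 := b.one_of_mem_closedBall (by simp [b.rIn_pos.le])
    simp [h3]
  have hc : ∀ n : ℕ, (0 : ℝ) < 1 / ((n : ℝ) + 1) := fun n => Nat.one_div_pos_of_nat
  let a : ℕ → 𝓢(Rd d, ℂ) := fun n => SchwartzMap.pairing (ContinuousLinearMap.mul ℂ ℂ)
    (SchwartzMap.compCLMOfContinuousLinearEquiv ℂ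
      (ContinuousLinearEquiv.smulLeft (Units.mk0 (1 / ((n : ℝ) + 1)) (hc n).ne')) χ) θ
  have ha : Filter.Tendsto a Filter.atTop (nhds θ) := by
    rw [(schwartz_withSeminorms ℂ (Rd d) ℂ).tendsto_nhds]
    rintro ⟨k, l⟩ ε hε
    obtain ⟨M, hM⟩ := seminorm_cutoff_le χ θ hχ k l
    have hlim : Filter.Tendsto (fun n : ℕ => 1 / ((n : ℝ) + 1) * M) Filter.atTop (nhds 0) := by
      simpa using tendsto_one_div_add_atTop_nhds_zero_nat.mul_const M
    filter_upwards [hlim.eventually_lt_const hε] with n hn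
    refine lt_of_le_of_lt (hM _ (hc n) ?_ (a n - θ) fun x => ?_) hn
    · rw [div_le_one (by positivity)]
      linarith [Nat.cast_nonneg (α := ℝ) n]
    · simp [a, sub_mul, Units.smul_def]
  have h0 : ∀ n, L (a n) = 0 := fun n => hL _ _
  have h1 := (L.continuous.tendsto θ).comp ha
  simp only [Function.comp_def, h0] at h1
  exact (tendsto_const_nhds_iff.mp h1).symm

lemma isConvolution_unique {B : E₀ →L[ℂ] E₁ →L[ℂ] E₂} {u : 𝓢'(Rd d, E₀)} {v : 𝓢'(Rd d, E₁)}
    {h h' : 𝓢'(Rd d, E₂)} (H : IsConvolution B u v h) (H' : IsConvolution B u v h') :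
    h = h' := by
  let L : 𝓢(Rd d, ℂ) →L[ℂ] E₂ := ((h - h' : 𝓢'(Rd d, E₂)) : 𝓢(Rd d, ℂ) →L[ℂ] E₂) ∘L
    (reflectAt 0 ∘L fourierInvCLM ℂ 𝓢(Rd d, ℂ))
  have hL : ∀ θ, L θ = 0 := by
    apply eq_zero_of_forall_pairing
    intro a b
    have e := (H (𝓕⁻ a) (𝓕⁻ b) 0).2.symm.trans (H' (𝓕⁻ a) (𝓕⁻ b) 0).2
    have e2 : schwartzConv (𝓕⁻ a) (𝓕⁻ b) =
        𝓕⁻ (SchwartzMap.pairing (ContinuousLinearMap.mul ℂ ℂ) a b) := by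
      simp [schwartzConv, SchwartzMap.convolution]
    rw [e2] at e
    exact sub_eq_zero.mpr e
  ext θ
  have := hL (𝓕 (reflectAt 0 θ))
  have e3 : reflectAt 0 (𝓕⁻ (𝓕 (reflectAt 0 θ))) = θ := by
    ext y; simp [reflectAt_apply]
  have e4 : (h - h') (reflectAt 0 (𝓕⁻ (𝓕 (reflectAt 0 θ)))) = 0 := this
  rw [e3] at e4
  exact sub_eq_zero.mp e4

lemma mem_fourierMultiplier_graph_iff {B : E₀ →L[ℂ] E₁ →L[ℂ] E₂} {μ : 𝓢'(Rd d, E₀)}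
    {f : 𝓢'(Rd d, E₁)} {h : 𝓢'(Rd d, E₂)} :
    (f, h) ∈ (fourierMultiplier B μ).graph ↔ IsConvolution B (𝓕⁻ μ) f h := by
  rw [fourierMultiplier, Submodule.toLinearPMap_graph_eq]
  · rfl
  · rintro ⟨v, h⟩ hx hv
    obtain rfl : v = 0 := hv
    exact isConvolution_unique hx (convolutionGraph B (𝓕⁻ μ)).zero_mem

end Convolution

end TimeFrequency

end

universe u₀ u₁ u₂

open TimeFrequency

/-! Put u = 𝓕⁻μ and let M_ξ denote modulation. Up to a factor of modulus one, V_g f(x, ξ) is (f *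
M_ξ γ)(x) with γ = conj g(-·), so a modulation norm is a mixed norm of the smoothings f * M_ξ γ
(`modulationNorm_eq`). The Fourier transform exchanges position and frequency, so the amalgam norm
of μ is the same kind of mixed norm of u (`amalgamNorm_eq`): u * M_ξ γ lies in L¹ with weight
⟨x⟩^|r|, with norm of size ⟨ξ⟩^(-δ).

The estimate rests on M_ξ(φ * ψ) = M_ξ φ * M_ξ ψ. If h = u * f exists, then h * M_ξ(φ * ψ) = (u *
M_ξ φ) * (f * M_ξ ψ), so ξ is a mere parameter. Peetre's inequality and Young's inequality L¹ * L^p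
⊂ L^p in x, then a supremum bound in ξ, give `IsConvolution.mixedNorm_le`.

Change of window uses the reproducing formula κ(0) θ = ∫ θ * M_ξ κ dξ
(`smul_map_eq_integral_modulate`) with κ = γ * γ~, γ~ = conj γ(-·), so that κ(0) = ‖γ‖₂² ≠ 0. It
writes f * M_η ψ as an integral of the functions f * M_ξ γ convolved with kernels that decay rapidly
in x and in ξ - η (`exists_convDominated_amplitude`). Young's inequality then compares mixed norms,
with constants independent of the space of values; Hölder's inequality instead of Young's turns the
norms into pointwise bounds for all smoothings.

Existence of h uses no density argument. With κ = ρ * a and κ(0) ≠ 0, the reproducing formula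
suggests the definition κ(0) h * θ = ∫ (u * M_ξ a) * (f * θ * M_ξ ρ) dξ. The factor θ * M_ξ ρ decays
rapidly in ξ, hence the integral converges absolutely and is continuous in θ
(`exists_distribution`); for θ = φ * ψ, moving test functions between the factors and applying the
formula once more gives κ(0) (u * φ) * (f * ψ) (`exists_isConvolution`).

All these manipulations need continuous linear maps on Schwartz functions to commute with absolutely
convergent integrals, which is `map_eq_integral_of_forall_eval`. -/

noncomputable section

namespace TimeFrequency

/-! ### Integral inequalities for functions with values in `[0, ∞]` -/

section Lp

variable {α β : Type*} [MeasurableSpace α] [MeasurableSpace β] {m : Measure α} {n : Measure β}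

lemma eLpNorm_const_mul_ennreal (c : ℝ≥0∞) {a : α → ℝ≥0∞} (ha : Measurable a) (p : ℝ≥0∞) :
    eLpNorm (fun x => c * a x) p m ≤ c * eLpNorm a p m := by
  rcases eq_or_ne p 0 with rfl | hp0
  · simp
  rcases eq_or_ne p ∞ with rfl | hpt
  · simp only [eLpNorm_exponent_top, eLpNormEssSup, enorm_eq_self]
    exact (ENNReal.essSup_const_mul).le
  · have hP : 0 < p.toReal := ENNReal.toReal_pos hp0 hpt
    simp only [eLpNorm_eq_lintegral_rpow_enorm_toReal hp0 hpt, enorm_eq_self,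
      ENNReal.mul_rpow_of_nonneg _ _ hP.le]
    rw [lintegral_const_mul _ (ha.pow_const _), ENNReal.mul_rpow_of_nonneg _ _ (by positivity),
      ← ENNReal.rpow_mul, mul_one_div_cancel hP.ne', ENNReal.rpow_one]

/-- The case `p = ∞` is the delicate one: an essential supremum over a slice is at most `c` exactly
when the slice of the measurable set where `b > c` is null, and measures of slices depend measurably
on the parameter. -/
lemma measurable_eLpNorm_right [SFinite m] {b : α → β → ℝ≥0∞}
    (hb : Measurable (Function.uncurry b)) (p : ℝ≥0∞) :
    Measurable fun ξ => eLpNorm (fun y => b y ξ) p m := by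
  rcases eq_or_ne p 0 with rfl | hp0
  · simp
  rcases eq_or_ne p ∞ with rfl | hpt
  · simp only [eLpNorm_exponent_top, eLpNormEssSup, enorm_eq_self]
    refine measurable_of_Iic fun c => ?_
    have hS : MeasurableSet {z : β × α | c < b z.2 z.1} :=
      measurableSet_lt measurable_const (hb.comp measurable_swap)
    have : (fun ξ => essSup (fun y => b y ξ) m) ⁻¹' Set.Iic c =
        (fun ξ => m (Prod.mk ξ ⁻¹' {z : β × α | c < b z.2 z.1})) ⁻¹' {0} := by
      ext ξ
      simp only [Set.mem_preimage, Set.mem_Iic, Set.mem_singleton_iff]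
      constructor
      · intro h
        have h1 := ENNReal.ae_le_essSup (μ := m) (fun y => b y ξ)
        have : ∀ᵐ y ∂m, b y ξ ≤ c := h1.mono fun y hy => hy.trans h
        simpa [ae_iff] using this
      · intro h
        refine essSup_le_of_ae_le c ?_
        simpa [Filter.EventuallyLE, ae_iff] using h
    rw [this]
    exact (measurable_measure_prodMk_left hS) (measurableSet_singleton 0)
  · simp only [eLpNorm_eq_lintegral_rpow_enorm_toReal hp0 hpt, enorm_eq_self]
    exact (Measurable.lintegral_prod_left' (hb.pow_const p.toReal)).pow_const _

/-- Hölder's inequality against a bounded integrable weight. -/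
lemma lintegral_mul_le_eLpNorm_mul {a k : α → ℝ≥0∞} (ha : Measurable a) (hk : Measurable k)
    (hk1 : ∀ x, k x ≤ 1) {p : ℝ≥0∞} (hp : 1 ≤ p) :
    ∫⁻ x, a x * k x ∂m ≤ eLpNorm a p m * (1 + ∫⁻ x, k x ∂m) := by
  rcases eq_or_ne p ∞ with rfl | hpt
  · calc ∫⁻ x, a x * k x ∂m ≤ ∫⁻ x, eLpNorm a ∞ m * k x ∂m := by
          refine lintegral_mono_ae ?_
          filter_upwards [ENNReal.ae_le_essSup (μ := m) a] with x hx
          gcongr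
          simpa [eLpNormEssSup] using hx
      _ = eLpNorm a ∞ m * ∫⁻ x, k x ∂m := lintegral_const_mul _ hk
      _ ≤ _ := by gcongr; exact le_add_self
  rcases eq_or_lt_of_le hp with rfl | hp1
  · calc ∫⁻ x, a x * k x ∂m ≤ ∫⁻ x, a x * 1 ∂m := by gcongr with x; exact hk1 x
      _ = eLpNorm a 1 m * 1 := by simp [eLpNorm_one_eq_lintegral_enorm]
      _ ≤ _ := by gcongr; exact le_self_add
  · have hp0 : p ≠ 0 := (zero_lt_one.trans hp1).ne'
    have hP : 1 < p.toReal := by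
      rw [← ENNReal.toReal_one]; exact (ENNReal.toReal_lt_toReal (by simp) hpt).2 hp1
    have hpq := Real.HolderConjugate.conjExponent hP
    refine (ENNReal.lintegral_mul_le_Lp_mul_Lq m hpq ha.aemeasurable hk.aemeasurable).trans ?_
    rw [eLpNorm_eq_lintegral_rpow_enorm_toReal hp0 hpt]
    simp only [enorm_eq_self]
    gcongr
    have hQ := hpq.symm.lt
    calc (∫⁻ x, k x ^ p.toReal.conjExponent ∂m) ^ (1 / p.toReal.conjExponent)
        ≤ (1 + ∫⁻ x, k x ∂m) ^ (1 / p.toReal.conjExponent) := by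
          gcongr
          refine (lintegral_mono fun x => ?_).trans le_add_self
          calc k x ^ p.toReal.conjExponent ≤ k x ^ (1 : ℝ) :=
                ENNReal.rpow_le_rpow_of_exponent_ge (hk1 x) hQ.le
            _ = k x := ENNReal.rpow_one _
      -- The summand 1 makes the base at least 1, so the exponent may be raised to 1. It thus yields
      -- one constant for all `p`.
      _ ≤ (1 + ∫⁻ x, k x ∂m) ^ (1 : ℝ) := by
          refine ENNReal.rpow_le_rpow_of_exponent_le le_self_add ?_
          rw [div_le_one (by linarith)]; exact hQ.le
      _ = _ := ENNReal.rpow_one _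

/-- Minkowski's integral inequality. -/
theorem eLpNorm_lintegral_le [SigmaFinite m] [SFinite n] {b : α → β → ℝ≥0∞}
    (hb : Measurable (Function.uncurry b)) {p : ℝ≥0∞} (hp : 1 ≤ p) :
    eLpNorm (fun y => ∫⁻ ξ, b y ξ ∂n) p m ≤ ∫⁻ ξ, eLpNorm (fun y => b y ξ) p m ∂n := by
  have hswap : Measurable (Function.uncurry fun (ξ : β) (y : α) => b y ξ) :=
    hb.comp measurable_swap
  rcases eq_or_ne p ∞ with rfl | hpt
  · simp only [eLpNorm_exponent_top]
    refine eLpNormEssSup_le_of_ae_enorm_bound ?_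
    have hmeas : MeasurableSet {z : β × α | b z.2 z.1 ≤ eLpNorm (fun y => b y z.1) ∞ m} :=
      measurableSet_le hswap ((measurable_eLpNorm_right hb ∞).comp measurable_fst)
    have h1 : ∀ᵐ z ∂(n.prod m), b z.2 z.1 ≤ eLpNorm (fun y => b y z.1) ∞ m := by
      rw [Measure.ae_prod_iff_ae_ae hmeas]
      refine Filter.Eventually.of_forall fun ξ => ?_
      filter_upwards [ENNReal.ae_le_essSup (μ := m) (fun y => b y ξ)] with y hy
      simpa [eLpNormEssSup] using hy
    have h2 : ∀ᵐ y ∂m, ∀ᵐ ξ ∂n, b y ξ ≤ eLpNorm (fun y => b y ξ) ∞ m := by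
      have hm' : MeasurableSet {z : α × β | b z.1 z.2 ≤ eLpNorm (fun y => b y z.2) ∞ m} :=
        measurableSet_le hb ((measurable_eLpNorm_right hb ∞).comp measurable_snd)
      rw [← Measure.ae_prod_iff_ae_ae hm']
      exact (Measure.measurePreserving_swap (μ := m) (ν := n)).quasiMeasurePreserving.ae h1
    filter_upwards [h2] with y hy
    simpa using lintegral_mono_ae hy
  have hp0 : p ≠ 0 := (zero_lt_one.trans_le hp).ne'
  rcases eq_or_lt_of_le hp with rfl | hp1
  · simp only [eLpNorm_one_eq_lintegral_enorm, enorm_eq_self]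
    exact (lintegral_lintegral_swap hb.aemeasurable).le
  have hP : 1 < p.toReal := by
    rw [← ENNReal.toReal_one]; exact (ENNReal.toReal_lt_toReal (by simp) hpt).2 hp1
  have hP0 : 0 < p.toReal := zero_lt_one.trans hP
  have hpq := Real.HolderConjugate.conjExponent hP
  set P := p.toReal
  set Q := P.conjExponent
  set A := ∫⁻ ξ, eLpNorm (fun y => b y ξ) p m ∂n with hA
  rw [eLpNorm_eq_lintegral_rpow_enorm_toReal hp0 hpt]
  simp only [enorm_eq_self]
  have hQ0 : 0 < Q := hpq.symm.pos
  -- Duality argument: write g = g^(1/P) g^(1/Q), bound the first factor by the inner integral,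
  -- exchange the integrals and apply Hölder for each ξ. This gives I ≤ A I^(1/Q), and I^(1/Q) can
  -- be cancelled because I is finite.
  have key : ∀ g : SimpleFunc α ℝ≥0, (∀ x, (g x : ℝ≥0∞) ≤ (∫⁻ ξ, b x ξ ∂n) ^ P) →
      ∫⁻ x, g x ∂m < ∞ → (∫⁻ x, g x ∂m) ^ (1 / P) ≤ A := by
    intro g hgF hgfin
    set I := ∫⁻ x, (g x : ℝ≥0∞) ∂m with hI
    have hg : Measurable fun x => (g x : ℝ≥0∞) := g.measurable.coe_nnreal_ennreal
    rcases eq_or_ne I 0 with h0 | h0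
    · simp [h0, hP0]
    have h1 : I ≤ A * I ^ (1 / Q) := by
      calc I = ∫⁻ x, (g x : ℝ≥0∞) ^ (1 / P) * (g x : ℝ≥0∞) ^ (1 / Q) ∂m := by
            refine lintegral_congr fun x => ?_
            rw [← ENNReal.rpow_add_of_nonneg _ _ (by positivity) (by positivity), one_div, one_div,
              hpq.inv_add_inv_eq_one, ENNReal.rpow_one]
        _ ≤ ∫⁻ x, (∫⁻ ξ, b x ξ ∂n) * (g x : ℝ≥0∞) ^ (1 / Q) ∂m := by
            refine lintegral_mono fun x => ?_
            gcongr
            calc (g x : ℝ≥0∞) ^ (1 / P) ≤ ((∫⁻ ξ, b x ξ ∂n) ^ P) ^ (1 / P) := by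
                  gcongr; exact hgF x
              _ = _ := by rw [← ENNReal.rpow_mul, mul_one_div_cancel hP0.ne', ENNReal.rpow_one]
        _ = ∫⁻ x, ∫⁻ ξ, b x ξ * (g x : ℝ≥0∞) ^ (1 / Q) ∂n ∂m := by
            refine lintegral_congr fun x => ?_
            exact (lintegral_mul_const _ (hb.comp measurable_prodMk_left)).symm
        _ = ∫⁻ ξ, ∫⁻ x, b x ξ * (g x : ℝ≥0∞) ^ (1 / Q) ∂m ∂n := by
            refine lintegral_lintegral_swap ?_
            exact (hb.mul ((hg.comp measurable_fst).pow_const _)).aemeasurable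
        _ ≤ ∫⁻ ξ, eLpNorm (fun y => b y ξ) p m * I ^ (1 / Q) ∂n := by
            refine lintegral_mono fun ξ => ?_
            have hbξ : Measurable fun y => b y ξ := hb.comp measurable_prodMk_right
            refine (ENNReal.lintegral_mul_le_Lp_mul_Lq m hpq hbξ.aemeasurable
              (hg.pow_const _).aemeasurable).trans ?_
            rw [eLpNorm_eq_lintegral_rpow_enorm_toReal hp0 hpt]
            simp only [enorm_eq_self]
            gcongr
            refine le_of_eq ?_
            rw [hI]
            congr 2
            funext x
            rw [← ENNReal.rpow_mul, one_div_mul_cancel hQ0.ne', ENNReal.rpow_one]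
        _ = A * I ^ (1 / Q) := lintegral_mul_const _ (measurable_eLpNorm_right hb p)
    have hIq0 : I ^ (1 / Q) ≠ 0 := by
      simp [ENNReal.rpow_eq_zero_iff, h0, hQ0.le]
    have hIqt : I ^ (1 / Q) ≠ ∞ := ENNReal.rpow_ne_top_of_nonneg (by positivity) hgfin.ne
    have h2 : I = I ^ (1 / P) * I ^ (1 / Q) := by
      rw [← ENNReal.rpow_add_of_nonneg _ _ (by positivity) (by positivity), one_div, one_div,
        hpq.inv_add_inv_eq_one, ENNReal.rpow_one]
    exact (ENNReal.mul_le_mul_iff_left hIq0 hIqt).1 (h2.symm.le.trans h1)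
  have hmain : ∫⁻ x, (∫⁻ ξ, b x ξ ∂n) ^ P ∂m ≤ A ^ P := by
    refine le_of_forall_lt fun L hL => ?_
    rw [lintegral_eq_nnreal] at hL
    obtain ⟨f, hL⟩ := lt_iSup_iff.1 hL
    obtain ⟨hf, hL⟩ := lt_iSup_iff.1 hL
    have hL' : L < ∫⁻ x, f x ∂m := by
      rwa [← SimpleFunc.lintegral_eq_lintegral] at hL
    -- σ-finiteness of `m` provides approximants from below with finite integral, to which `key`
    -- applies.
    obtain ⟨g, hgf, hgfin, hgL⟩ := SimpleFunc.exists_lt_lintegral_simpleFunc_of_lt_lintegral hL'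
    have h3 := key g (fun x => (ENNReal.coe_le_coe.2 (hgf x)).trans (hf x)) hgfin
    refine hgL.trans_le ?_
    calc ∫⁻ x, (g x : ℝ≥0∞) ∂m = ((∫⁻ x, (g x : ℝ≥0∞) ∂m) ^ (1 / P)) ^ P := by
          rw [← ENNReal.rpow_mul, one_div_mul_cancel hP0.ne', ENNReal.rpow_one]
      _ ≤ A ^ P := by gcongr
  calc (∫⁻ x, (∫⁻ ξ, b x ξ ∂n) ^ P ∂m) ^ (1 / P) ≤ (A ^ P) ^ (1 / P) := by gcongr
    _ = A := by rw [← ENNReal.rpow_mul, mul_one_div_cancel hP0.ne', ENNReal.rpow_one]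

end Lp

/-! ### Polynomial weights, Peetre's inequality and weighted mixed norms. -/

section Weights

variable {d : ℕ}

lemma one_le_bracket (x : Rd d) : 1 ≤ bracket x := by
  rw [bracket, Real.one_le_sqrt]
  nlinarith [sq_nonneg ‖x‖]

lemma bracket_pos (x : Rd d) : 0 < bracket x := zero_lt_one.trans_le (one_le_bracket x)

lemma bracket_le_one_add_norm (x : Rd d) : bracket x ≤ 1 + ‖x‖ := sqrt_one_add_norm_sq_le x

lemma continuous_bracket : Continuous (bracket : Rd d → ℝ) := by
  unfold bracket; fun_prop

@[simp] lemma bracket_neg (x : Rd d) : bracket (-x) = bracket x := by simp [bracket]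

lemma bracket_add_le (x y : Rd d) : bracket (x + y) ≤ 2 * bracket x * bracket y := by
  have hx := Real.sq_sqrt (show 0 ≤ 1 + ‖x‖ ^ 2 by positivity)
  have hy := Real.sq_sqrt (show 0 ≤ 1 + ‖y‖ ^ 2 by positivity)
  rw [bracket, Real.sqrt_le_left (by have := bracket_pos x; have := bracket_pos y; positivity)]
  rw [mul_pow, mul_pow, bracket, bracket, hx, hy]
  have h1 : ‖x + y‖ ^ 2 ≤ (‖x‖ + ‖y‖) ^ 2 := by gcongr; exact norm_add_le x y
  nlinarith [sq_nonneg (‖x‖ - ‖y‖), sq_nonneg (‖x‖ * ‖y‖), sq_nonneg ‖x‖, sq_nonneg ‖y‖]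

/-- The weight `⟨x⟩ ^ r` with values in `[0, ∞]`. -/
def weight (r : ℝ) (x : Rd d) : ℝ≥0∞ := ENNReal.ofReal (bracket x ^ r)

lemma measurable_weight (r : ℝ) : Measurable (weight r : Rd d → ℝ≥0∞) :=
  (continuous_bracket.measurable.pow_const r).ennreal_ofReal

lemma weight_add (r s : ℝ) (x : Rd d) : weight (r + s) x = weight r x * weight s x := by
  rw [weight, weight, weight, ← ENNReal.ofReal_mul (Real.rpow_nonneg (bracket_pos x).le _),
    Real.rpow_add (bracket_pos x)]

@[simp] lemma weight_zero (x : Rd d) : weight 0 x = 1 := by simp [weight]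

@[simp] lemma weight_neg_arg (r : ℝ) (x : Rd d) : weight r (-x) = weight r x := by simp [weight]

lemma weight_ne_top (r : ℝ) (x : Rd d) : weight r x ≠ ∞ := ENNReal.ofReal_ne_top

lemma weight_mul_weight_neg (r : ℝ) (x : Rd d) : weight r x * weight (-r) x = 1 := by
  rw [← weight_add, add_neg_cancel, weight_zero]

lemma weight_le_weight {r s : ℝ} (h : r ≤ s) (x : Rd d) : weight r x ≤ weight s x :=
  ENNReal.ofReal_le_ofReal (Real.rpow_le_rpow_of_exponent_le (one_le_bracket x) h)

lemma weight_le_one {r : ℝ} (h : r ≤ 0) (x : Rd d) : weight r x ≤ 1 := by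
  simpa using weight_le_weight h x

/-- Peetre's inequality. -/
lemma weight_add_arg_le (r : ℝ) (x y : Rd d) :
    weight r (x + y) ≤ ENNReal.ofReal (2 ^ |r|) * (weight r x * weight |r| y) := by
  have hx := bracket_pos x
  have hy := bracket_pos y
  have hxy := bracket_pos (x + y)
  rw [weight, weight, weight, ← ENNReal.ofReal_mul (by positivity),
    ← ENNReal.ofReal_mul (by positivity)]
  refine ENNReal.ofReal_le_ofReal ?_
  rcases le_total 0 r with hr | hr
  · rw [abs_of_nonneg hr, ← mul_assoc, ← Real.mul_rpow (by positivity) hx.le,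
      ← Real.mul_rpow (by positivity) hy.le]
    exact Real.rpow_le_rpow hxy.le (bracket_add_le x y) hr
  -- For negative exponents the submultiplicativity is applied to x = (x + y) + (-y).
  · rw [abs_of_nonpos hr]
    have h1 : bracket x ≤ 2 * bracket (x + y) * bracket y := by
      simpa using bracket_add_le (x + y) (-y)
    have h2 : bracket x ^ (-r) ≤ (2 * bracket (x + y) * bracket y) ^ (-r) :=
      Real.rpow_le_rpow hx.le h1 (by linarith)
    rw [Real.mul_rpow (by positivity) hy.le, Real.mul_rpow (by positivity) hxy.le] at h2
    have h3 : bracket x ^ r * bracket x ^ (-r) = 1 := by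
      rw [← Real.rpow_add hx]; simp
    have h4 : bracket (x + y) ^ r * bracket (x + y) ^ (-r) = 1 := by
      rw [← Real.rpow_add hxy]; simp
    calc bracket (x + y) ^ r = bracket (x + y) ^ r * (bracket x ^ r * bracket x ^ (-r)) := by
          rw [h3, mul_one]
      _ ≤ bracket (x + y) ^ r *
          (bracket x ^ r * (2 ^ (-r) * bracket (x + y) ^ (-r) * bracket y ^ (-r))) := by
          gcongr
      _ = (bracket (x + y) ^ r * bracket (x + y) ^ (-r)) *
          (2 ^ (-r) * (bracket x ^ r * bracket y ^ (-r))) := by ring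
      _ = _ := by rw [h4, one_mul]

lemma lintegral_weight_lt_top {r : ℝ} (hr : (d : ℝ) < r) :
    ∫⁻ x : Rd d, weight (-r) x < ∞ := by
  have h := integrable_rpow_neg_one_add_norm_sq (E := Rd d) (μ := volume) (r := r) (by simpa using hr)
  have e : ∀ x : Rd d, weight (-r) x = ENNReal.ofReal ((1 + ‖x‖ ^ 2) ^ (-r / 2)) := by
    intro x
    rw [weight, bracket, Real.sqrt_eq_rpow, ← Real.rpow_mul (by positivity)]
    congr 2; ring
  simp_rw [e]
  exact h.lintegral_lt_top

/-- Young's inequality. -/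
lemma eLpNorm_lconvolution_le {a k : Rd d → ℝ≥0∞} (ha : Measurable a) (hk : Measurable k)
    {p : ℝ≥0∞} (hp : 1 ≤ p) :
    eLpNorm (fun x => ∫⁻ z, a (x - z) * k z) p volume ≤ eLpNorm a p volume * ∫⁻ z, k z := by
  have hb : Measurable (Function.uncurry fun x z : Rd d => a (x - z) * k z) :=
    (ha.comp (measurable_fst.sub measurable_snd)).mul (hk.comp measurable_snd)
  refine (eLpNorm_lintegral_le hb hp).trans ?_
  rw [← lintegral_const_mul _ hk]
  refine lintegral_mono fun z => ?_
  have h1 : Measurable fun x : Rd d => a (x - z) := ha.comp (measurable_id.sub_const z)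
  simp_rw [mul_comm _ (k z)]
  refine (eLpNorm_const_mul_ennreal (k z) h1 p).trans_eq ?_
  congr 1
  exact eLpNorm_comp_measurePreserving ha.aestronglyMeasurable (measurePreserving_sub_right volume z)

/-- The mixed weighted norm of a function on `ℝᵈ × ℝᵈ`: the `L^p_r` norm in the first variable,
followed by the `L^q_s` norm in the second. -/
def mixedNorm (p q : ℝ≥0∞) (r s : ℝ) (Φ : Rd d → Rd d → ℝ≥0∞) : ℝ≥0∞ :=
  eLpNorm (fun ξ => eLpNorm (fun x => weight r x * Φ x ξ) p volume * weight s ξ) q volume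

variable {p q : ℝ≥0∞} {r s : ℝ} {Φ Ψ : Rd d → Rd d → ℝ≥0∞}

/-- The constant that arises when a weight is distributed over a convolution against `weight (-M)`. -/
def peetreConst (d : ℕ) (r M : ℝ) : ℝ≥0∞ :=
  ENNReal.ofReal (2 ^ |r|) * (1 + ∫⁻ z : Rd d, weight (|r| - M) z)

lemma peetreConst_lt_top {M : ℝ} (hM : d + |r| < M) : peetreConst d r M < ∞ := by
  refine ENNReal.mul_lt_top ENNReal.ofReal_lt_top (ENNReal.add_lt_top.2 ⟨by simp, ?_⟩)
  have := lintegral_weight_lt_top (d := d) (r := M - |r|) (by linarith)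
  rwa [neg_sub] at this

/-- Peetre's inequality distributes ⟨x⟩^r over x - z and z; the factor ⟨z⟩^|r| is paid for by the
decay of the kernel, whose exponent drops from M to M - |r|. -/
lemma weight_mul_lintegral_le (r M : ℝ) {a : Rd d → ℝ≥0∞} (ha : Measurable a) (x : Rd d) :
    weight r x * ∫⁻ z, a (x - z) * weight (-M) z ≤
      ENNReal.ofReal (2 ^ |r|) * ∫⁻ z, (weight r (x - z) * a (x - z)) * weight (|r| - M) z := by
  have hm : ∀ N, Measurable fun z : Rd d => a (x - z) * weight N z := fun N =>
    (ha.comp (measurable_const.sub measurable_id)).mul (measurable_weight N)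
  rw [← lintegral_const_mul _ (hm _), ← lintegral_const_mul]
  · refine lintegral_mono fun z => ?_
    have := weight_add_arg_le r (x - z) z
    rw [sub_add_cancel] at this
    calc _ ≤ (ENNReal.ofReal (2 ^ |r|) * (weight r (x - z) * weight |r| z)) *
          (a (x - z) * weight (-M) z) := by gcongr
      _ = _ := by rw [sub_eq_add_neg |r| M, weight_add]; ring
  · exact (((measurable_weight r).mul ha).comp (measurable_const.sub measurable_id)).mul
      (measurable_weight _)

lemma eLpNorm_comp_sub_left {a : Rd d → ℝ≥0∞} (ha : Measurable a) (x : Rd d) (p : ℝ≥0∞) :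
    eLpNorm (fun z => a (x - z)) p volume = eLpNorm a p volume :=
  eLpNorm_comp_measurePreserving ha.aestronglyMeasurable (Measure.measurePreserving_sub_left volume x)

/-- Hölder's inequality turns an L^p norm into a bound at every point. The condition |r| ≤ M keeps
the remaining kernel below 1. -/
lemma weight_mul_lintegral_le_eLpNorm (hp : 1 ≤ p) {M : ℝ} (hM : |r| ≤ M)
    {a : Rd d → ℝ≥0∞} (ha : Measurable a) (x : Rd d) :
    weight r x * ∫⁻ z, a (x - z) * weight (-M) z ≤
      peetreConst d r M * eLpNorm (fun x => weight r x * a x) p volume := by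
  refine (weight_mul_lintegral_le r M ha x).trans ?_
  have hwa : Measurable fun x => weight r x * a x := (measurable_weight r).mul ha
  have hwx : Measurable fun z => weight r (x - z) * a (x - z) :=
    hwa.comp (measurable_const.sub measurable_id)
  have h1 := lintegral_mul_le_eLpNorm_mul (m := volume) hwx
    (measurable_weight (|r| - M)) (weight_le_one (by linarith)) hp
  rw [eLpNorm_comp_sub_left hwa x p] at h1
  rw [peetreConst, mul_assoc, mul_comm (1 + _)]
  exact mul_le_mul' le_rfl h1

lemma eLpNorm_weight_mul_lintegral_le (hp : 1 ≤ p) {M : ℝ} {a : Rd d → ℝ≥0∞} (ha : Measurable a) :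
    eLpNorm (fun x => weight r x * ∫⁻ z, a (x - z) * weight (-M) z) p volume ≤
      peetreConst d r M * eLpNorm (fun x => weight r x * a x) p volume := by
  have hwa : Measurable fun x => weight r x * a x := (measurable_weight r).mul ha
  have hm : Measurable fun x => ∫⁻ z, (weight r (x - z) * a (x - z)) * weight (|r| - M) z := by
    refine Measurable.lintegral_prod_right' (f := fun z : Rd d × Rd d =>
      (weight r (z.1 - z.2) * a (z.1 - z.2)) * weight (|r| - M) z.2) ?_
    exact (hwa.comp (measurable_fst.sub measurable_snd)).mul ((measurable_weight _).comp measurable_snd)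
  calc _ ≤ eLpNorm (fun x => ENNReal.ofReal (2 ^ |r|) *
        ∫⁻ z, (weight r (x - z) * a (x - z)) * weight (|r| - M) z) p volume :=
        eLpNorm_mono_enorm fun x => weight_mul_lintegral_le r M ha x
    _ ≤ ENNReal.ofReal (2 ^ |r|) * eLpNorm (fun x =>
        ∫⁻ z, (weight r (x - z) * a (x - z)) * weight (|r| - M) z) p volume :=
        eLpNorm_const_mul_ennreal _ hm p
    _ ≤ ENNReal.ofReal (2 ^ |r|) * (eLpNorm (fun x => weight r x * a x) p volume *
        ∫⁻ z, weight (|r| - M) z) := by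
        gcongr
        exact eLpNorm_lconvolution_le hwa (measurable_weight _) hp
    _ ≤ _ := by
        rw [peetreConst, mul_assoc, mul_comm (1 + _)]
        gcongr
        exact le_add_self

/-- `Ψ` is dominated by the convolution of `Φ` with a rapidly decreasing kernel. -/
def ConvDominated (C : ℝ≥0∞) (M : ℝ) (Φ Ψ : Rd d → Rd d → ℝ≥0∞) : Prop :=
  ∀ x η, Ψ x η ≤ C * ∫⁻ ξ, (∫⁻ z, Φ (x - z) (η - ξ) * weight (-M) z) * weight (-M) ξ

lemma measurable_weight_mul (hΦ : Measurable (Function.uncurry Φ)) (r : ℝ) :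
    Measurable (Function.uncurry fun x ξ => weight r x * Φ x ξ) :=
  ((measurable_weight r).comp measurable_fst).mul hΦ

/-- Minkowski's inequality moves the L^p norm inside the ξ-integral and Young's inequality removes
the z-integral. What remains is a convolution in frequency, to be treated by Young or by Hölder. -/
lemma ConvDominated.eLpNorm_le {C : ℝ≥0∞} {M : ℝ} (h : ConvDominated C M Φ Ψ)
    (hΦ : Measurable (Function.uncurry Φ)) (hp : 1 ≤ p) (η : Rd d) :
    eLpNorm (fun x => weight r x * Ψ x η) p volume ≤ C * (peetreConst d r M *
      ∫⁻ ξ, eLpNorm (fun x => weight r x * Φ x (η - ξ)) p volume * weight (-M) ξ) := by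
  have hm0 : Measurable fun z : (Rd d × Rd d) × Rd d =>
      Φ (z.1.1 - z.2) (η - z.1.2) * weight (-M) z.2 :=
    (hΦ.comp (((measurable_fst.comp measurable_fst).sub measurable_snd).prodMk
      (measurable_const.sub (measurable_snd.comp measurable_fst)))).mul
      ((measurable_weight _).comp measurable_snd)
  have hm1 : Measurable fun z : Rd d × Rd d => ∫⁻ w, Φ (z.1 - w) (η - z.2) * weight (-M) w :=
    Measurable.lintegral_prod_right' hm0
  have hm2 : Measurable (Function.uncurry fun x ξ : Rd d =>
      weight r x * ((∫⁻ z, Φ (x - z) (η - ξ) * weight (-M) z) * weight (-M) ξ)) :=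
    ((measurable_weight r).comp measurable_fst).mul
      (hm1.mul ((measurable_weight _).comp measurable_snd))
  calc _ ≤ eLpNorm (fun x => C * ∫⁻ ξ,
        weight r x * ((∫⁻ z, Φ (x - z) (η - ξ) * weight (-M) z) * weight (-M) ξ)) p volume := by
        refine eLpNorm_mono_enorm fun x => ?_
        simp only [enorm_eq_self]
        rw [lintegral_const_mul' _ _ (weight_ne_top _ _), mul_left_comm]
        gcongr
        exact h x η
    _ ≤ C * eLpNorm (fun x => ∫⁻ ξ,
        weight r x * ((∫⁻ z, Φ (x - z) (η - ξ) * weight (-M) z) * weight (-M) ξ)) p volume :=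
        eLpNorm_const_mul_ennreal _ (Measurable.lintegral_prod_right' hm2) p
    _ ≤ C * ∫⁻ ξ, eLpNorm (fun x =>
        weight r x * ((∫⁻ z, Φ (x - z) (η - ξ) * weight (-M) z) * weight (-M) ξ)) p volume := by
        gcongr
        exact eLpNorm_lintegral_le hm2 hp
    _ ≤ C * ∫⁻ ξ, peetreConst d r M *
        (eLpNorm (fun x => weight r x * Φ x (η - ξ)) p volume * weight (-M) ξ) := by
        refine mul_le_mul' le_rfl (lintegral_mono fun ξ => ?_)
        have hΦξ : Measurable fun x => Φ x (η - ξ) := hΦ.comp measurable_prodMk_right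
        have hmξ : Measurable fun x => weight r x * ∫⁻ z, Φ (x - z) (η - ξ) * weight (-M) z :=
          (measurable_weight r).mul (hm1.comp measurable_prodMk_right)
        calc _ = eLpNorm (fun x => weight (-M) ξ *
              (weight r x * ∫⁻ z, Φ (x - z) (η - ξ) * weight (-M) z)) p volume := by
              simp only [mul_comm (weight (-M) ξ), mul_assoc]
          _ ≤ weight (-M) ξ * eLpNorm (fun x =>
              weight r x * ∫⁻ z, Φ (x - z) (η - ξ) * weight (-M) z) p volume :=
              eLpNorm_const_mul_ennreal _ hmξ p
          _ ≤ weight (-M) ξ * (peetreConst d r M *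
              eLpNorm (fun x => weight r x * Φ x (η - ξ)) p volume) := by
              have h2 := eLpNorm_weight_mul_lintegral_le (r := r) (M := M) hp hΦξ
              exact mul_le_mul' le_rfl h2
          _ = _ := by rw [mul_left_comm, mul_comm (weight (-M) ξ)]
    _ = _ := by
        congr 1
        refine lintegral_const_mul _ ?_
        refine Measurable.mul ?_ (measurable_weight _)
        exact (measurable_eLpNorm_right (measurable_weight_mul hΦ r) p).comp
          (measurable_const.sub measurable_id)

/-- Young in position, Hölder in frequency: the L^q norm in η becomes a supremum. -/
lemma ConvDominated.slice_le {C : ℝ≥0∞} {M : ℝ} (h : ConvDominated C M Φ Ψ)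
    (hΦ : Measurable (Function.uncurry Φ)) (hp : 1 ≤ p) (hq : 1 ≤ q) (hM : |s| ≤ M) (η : Rd d) :
    weight s η * eLpNorm (fun x => weight r x * Ψ x η) p volume ≤
      C * peetreConst d r M * peetreConst d s M * mixedNorm p q r s Φ := by
  have hA : Measurable fun ξ => eLpNorm (fun x => weight r x * Φ x ξ) p volume :=
    measurable_eLpNorm_right (measurable_weight_mul hΦ r) p
  have h1 := weight_mul_lintegral_le_eLpNorm (d := d) hq hM hA η
  calc _ ≤ weight s η * (C * (peetreConst d r M *
      ∫⁻ ξ, eLpNorm (fun x => weight r x * Φ x (η - ξ)) p volume * weight (-M) ξ)) := by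
        gcongr; exact h.eLpNorm_le hΦ hp η
    _ = C * peetreConst d r M * (weight s η *
      ∫⁻ ξ, eLpNorm (fun x => weight r x * Φ x (η - ξ)) p volume * weight (-M) ξ) := by ring
    _ ≤ C * peetreConst d r M * (peetreConst d s M * mixedNorm p q r s Φ) := by
        refine mul_le_mul' le_rfl (h1.trans_eq ?_)
        simp only [mixedNorm, mul_comm]
    _ = _ := by ring

/-- Young in both variables. -/
lemma ConvDominated.mixedNorm_le {C : ℝ≥0∞} {M : ℝ} (h : ConvDominated C M Φ Ψ)
    (hΦ : Measurable (Function.uncurry Φ)) (hp : 1 ≤ p) (hq : 1 ≤ q) :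
    mixedNorm p q r s Ψ ≤ C * peetreConst d r M * peetreConst d s M * mixedNorm p q r s Φ := by
  have hA : Measurable fun ξ => eLpNorm (fun x => weight r x * Φ x ξ) p volume :=
    measurable_eLpNorm_right (measurable_weight_mul hΦ r) p
  have hm : Measurable fun η => weight s η *
      ∫⁻ ξ, eLpNorm (fun x => weight r x * Φ x (η - ξ)) p volume * weight (-M) ξ := by
    refine (measurable_weight s).mul (Measurable.lintegral_prod_right' (f := fun z : Rd d × Rd d =>
      eLpNorm (fun x => weight r x * Φ x (z.1 - z.2)) p volume * weight (-M) z.2) ?_)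
    exact (hA.comp (measurable_fst.sub measurable_snd)).mul
      ((measurable_weight _).comp measurable_snd)
  calc mixedNorm p q r s Ψ ≤ eLpNorm (fun η => C * peetreConst d r M * (weight s η *
      ∫⁻ ξ, eLpNorm (fun x => weight r x * Φ x (η - ξ)) p volume * weight (-M) ξ)) q volume := by
        refine eLpNorm_mono_enorm fun η => ?_
        simp only [enorm_eq_self]
        calc _ ≤ (C * (peetreConst d r M *
            ∫⁻ ξ, eLpNorm (fun x => weight r x * Φ x (η - ξ)) p volume * weight (-M) ξ)) *
              weight s η := by
              gcongr; exact h.eLpNorm_le hΦ hp η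
          _ = _ := by ring
    _ ≤ C * peetreConst d r M * eLpNorm (fun η => weight s η *
      ∫⁻ ξ, eLpNorm (fun x => weight r x * Φ x (η - ξ)) p volume * weight (-M) ξ) q volume :=
        eLpNorm_const_mul_ennreal _ hm q
    _ ≤ C * peetreConst d r M * (peetreConst d s M * mixedNorm p q r s Φ) := by
        refine mul_le_mul' le_rfl ((eLpNorm_weight_mul_lintegral_le hq hA).trans_eq ?_)
        simp only [mixedNorm, mul_comm]
    _ = _ := by ring

/-- Hölder in both variables. -/
lemma ConvDominated.pointwise_le {C : ℝ≥0∞} {M : ℝ} (h : ConvDominated C M Φ Ψ)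
    (hΦ : Measurable (Function.uncurry Φ)) (hp : 1 ≤ p) (hq : 1 ≤ q) (hr : |r| ≤ M) (hs : |s| ≤ M)
    (x η : Rd d) :
    weight r x * (weight s η * Ψ x η) ≤
      C * peetreConst d r M * peetreConst d s M * mixedNorm p q r s Φ := by
  have hA : Measurable fun ξ => eLpNorm (fun x => weight r x * Φ x ξ) p volume :=
    measurable_eLpNorm_right (measurable_weight_mul hΦ r) p
  have h1 := weight_mul_lintegral_le_eLpNorm (d := d) hq hs hA η
  calc _ ≤ weight r x * (weight s η *
        (C * ∫⁻ ξ, (∫⁻ z, Φ (x - z) (η - ξ) * weight (-M) z) * weight (-M) ξ)) := by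
        gcongr; exact h x η
    _ = C * (weight s η * ∫⁻ ξ,
        weight r x * ((∫⁻ z, Φ (x - z) (η - ξ) * weight (-M) z) * weight (-M) ξ)) := by
        rw [lintegral_const_mul' _ _ (weight_ne_top _ _)]; ring
    _ ≤ C * (weight s η * ∫⁻ ξ, peetreConst d r M *
        (eLpNorm (fun x => weight r x * Φ x (η - ξ)) p volume * weight (-M) ξ)) := by
        refine mul_le_mul' le_rfl (mul_le_mul' le_rfl (lintegral_mono fun ξ => ?_))
        rw [← mul_assoc, ← mul_assoc]
        refine mul_le_mul' ?_ le_rfl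
        exact weight_mul_lintegral_le_eLpNorm hp hr (hΦ.comp measurable_prodMk_right) x
    _ = C * peetreConst d r M * (weight s η *
      ∫⁻ ξ, eLpNorm (fun x => weight r x * Φ x (η - ξ)) p volume * weight (-M) ξ) := by
        rw [lintegral_const_mul]
        · ring
        · exact (hA.comp (measurable_const.sub measurable_id)).mul (measurable_weight _)
    _ ≤ C * peetreConst d r M * (peetreConst d s M * mixedNorm p q r s Φ) := by
        refine mul_le_mul' le_rfl (h1.trans_eq ?_)
        simp only [mixedNorm, mul_comm]
    _ = _ := by ring

end Weights

/-! ### Continuous linear maps and integrals of families of Schwartz functions -/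

section Interchange

open BoundedContinuousFunction LineDeriv

variable {d : ℕ}

/-- Points at which the `l`-th derivative of a function on `ℝᵈ` is evaluated: a base point and
`l` vectors in the unit ball. -/
abbrev JetDomain (d l : ℕ) : Type := Rd d × (Fin l → Metric.closedBall (0 : Rd d) 1)

lemma norm_pow_mul_iteratedFDeriv_apply_le (k l : ℕ) (φ : 𝓢(Rd d, ℂ)) (z : JetDomain d l) :
    ‖((‖z.1‖ ^ k : ℝ) : ℂ) * iteratedFDeriv ℝ l φ z.1 (fun i => z.2 i)‖ ≤
      SchwartzMap.seminorm ℂ k l φ := by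
  refine le_trans ?_ (SchwartzMap.le_seminorm ℂ k l φ z.1)
  rw [norm_mul, Complex.norm_real, norm_pow, norm_norm]
  gcongr
  refine (ContinuousMultilinearMap.le_opNorm _ _).trans (mul_le_of_le_one_right (norm_nonneg _) ?_)
  exact Finset.prod_le_one (fun _ _ => norm_nonneg _) fun i _ =>
    mem_closedBall_zero_iff.1 (z.2 i).2

/-- The bounded function `(x, v) ↦ ‖x‖ ^ k * D^l φ x v`, whose norm is a Schwartz seminorm
of `φ`. -/
def jetCLM (k l : ℕ) : 𝓢(Rd d, ℂ) →L[ℂ] (JetDomain d l →ᵇ ℂ) :=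
  SchwartzMap.mkCLMtoNormedSpace
    (fun φ => BoundedContinuousFunction.ofNormedAddCommGroup
      (fun z : JetDomain d l => ((‖z.1‖ ^ k : ℝ) : ℂ) * iteratedFDeriv ℝ l φ z.1 (fun i => z.2 i))
      (by
        have h1 : Continuous fun z : JetDomain d l => iteratedFDeriv ℝ l φ z.1 :=
          ((φ.smooth l).continuous_iteratedFDeriv le_rfl).comp continuous_fst
        have h2 : Continuous fun z : JetDomain d l => fun i => (z.2 i : Rd d) := by fun_prop
        have h3 : Continuous fun z : JetDomain d l => ((‖z.1‖ ^ k : ℝ) : ℂ) := by fun_prop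
        exact h3.mul (h1.eval h2))
      (SchwartzMap.seminorm ℂ k l φ) (norm_pow_mul_iteratedFDeriv_apply_le k l φ))
    (fun φ ψ => by
      ext1 z
      simp only [← SchwartzMap.iteratedLineDerivOp_eq_iteratedFDeriv, iteratedLineDerivOp_add,
        coe_ofNormedAddCommGroup, coe_add, Pi.add_apply]
      exact mul_add _ _ _)
    (fun c φ => by
      ext1 z
      simp only [← SchwartzMap.iteratedLineDerivOp_eq_iteratedFDeriv, iteratedLineDerivOp_smul,
        coe_ofNormedAddCommGroup, coe_smul, smul_eq_mul, RingHom.id_apply]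
      exact mul_left_comm _ _ _)
    ⟨{(k, l)}, 1, zero_le_one, fun φ => by
      refine (BoundedContinuousFunction.norm_ofNormedAddCommGroup_le _
        (apply_nonneg _ _) (norm_pow_mul_iteratedFDeriv_apply_le k l φ)).trans ?_
      simp [schwartzSeminormFamily]⟩

lemma jetCLM_apply (k l : ℕ) (φ : 𝓢(Rd d, ℂ)) (z : JetDomain d l) :
    jetCLM k l φ z = ((‖z.1‖ ^ k : ℝ) : ℂ) * ∂^{fun i => (z.2 i : Rd d)} φ z.1 := by
  rw [SchwartzMap.iteratedLineDerivOp_eq_iteratedFDeriv]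
  rfl

/-- By homogeneity the operator norm of a multilinear map is already seen on vectors of the unit
ball. -/
lemma norm_jetCLM (k l : ℕ) (φ : 𝓢(Rd d, ℂ)) : ‖jetCLM k l φ‖ = SchwartzMap.seminorm ℂ k l φ := by
  refine le_antisymm ?_ ?_
  · exact BoundedContinuousFunction.norm_ofNormedAddCommGroup_le _ (apply_nonneg _ _)
      (norm_pow_mul_iteratedFDeriv_apply_le k l φ)
  · refine SchwartzMap.seminorm_le_bound ℂ k l φ (norm_nonneg _) fun x => ?_
    rcases eq_or_ne (‖x‖ ^ k) 0 with h0 | h0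
    · rw [h0, zero_mul]; exact norm_nonneg _
    have hpos : 0 < ‖x‖ ^ k := lt_of_le_of_ne (by positivity) h0.symm
    rw [mul_comm, ← le_div_iff₀ hpos]
    refine ContinuousMultilinearMap.opNorm_le_bound (by positivity) fun w => ?_
    have hu : ∀ i, ‖w i‖⁻¹ • w i ∈ Metric.closedBall (0 : Rd d) 1 := fun i => by
      rw [mem_closedBall_zero_iff, norm_smul, norm_inv, norm_norm]
      exact inv_mul_le_one
    have hw : w = fun i => ‖w i‖ • (‖w i‖⁻¹ • w i) := by
      funext i
      rcases eq_or_ne (w i) 0 with h | h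
      · simp [h]
      · rw [smul_inv_smul₀ (norm_ne_zero_iff.2 h)]
    have h1 := (jetCLM k l φ).norm_coe_le_norm (x, fun i => ⟨_, hu i⟩)
    rw [jetCLM_apply, SchwartzMap.iteratedLineDerivOp_eq_iteratedFDeriv, norm_mul,
      Complex.norm_real, Real.norm_of_nonneg hpos.le, mul_comm, ← le_div_iff₀ hpos] at h1
    have h2 : iteratedFDeriv ℝ l φ x w = (∏ i, ‖w i‖) •
        iteratedFDeriv ℝ l φ x (fun i => ‖w i‖⁻¹ • w i) := by
      conv_lhs => rw [hw]
      exact ContinuousMultilinearMap.map_smul_univ _ _ _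
    rw [h2, norm_smul, Real.norm_of_nonneg (Finset.prod_nonneg fun _ _ => norm_nonneg _), mul_comm]
    exact mul_le_mul_of_nonneg_right h1 (Finset.prod_nonneg fun _ _ => norm_nonneg _)

variable {X : Type*} [TopologicalSpace X] [MeasurableSpace X] [OpensMeasurableSpace X]
  {m : Measure X}

/-- A continuous seminorm is dominated by a multiple of a finite sum of Schwartz seminorms. -/
lemma integrable_seminorm {Φ : X → 𝓢(Rd d, ℂ)} (hΦ : Continuous Φ)
    (hΦint : ∀ k l, Integrable (fun x => SchwartzMap.seminorm ℂ k l (Φ x)) m)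
    {q : Seminorm ℂ 𝓢(Rd d, ℂ)} (hq : Continuous q) : Integrable (fun x => q (Φ x)) m := by
  obtain ⟨s, C, -, hC⟩ := Seminorm.bound_of_continuous (schwartz_withSeminorms ℂ (Rd d) ℂ) q hq
  have hb : Integrable (fun x => C * ∑ i ∈ s, SchwartzMap.seminorm ℂ i.1 i.2 (Φ x)) m :=
    (integrable_finsetSum _ fun i _ => hΦint _ _).const_mul _
  refine hb.mono' (hq.comp hΦ).aestronglyMeasurable (.of_forall fun x => ?_)
  rw [Real.norm_of_nonneg (apply_nonneg _ _)]
  refine (hC (Φ x)).trans ?_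
  refine mul_le_mul_of_nonneg_left (Seminorm.finset_sup_apply_le
    (Finset.sum_nonneg fun i _ => apply_nonneg _ _) fun i hi => ?_) C.2
  exact Finset.single_le_sum (f := fun i => SchwartzMap.seminorm ℂ i.1 i.2 (Φ x))
    (fun i _ => apply_nonneg _ _) hi

/-- The integrability hypothesis is stable under continuous linear maps, in particular under
derivatives; this permits induction on their order. -/
lemma integrable_seminorm_map {Φ : X → 𝓢(Rd d, ℂ)} (hΦ : Continuous Φ)
    (hΦint : ∀ k l, Integrable (fun x => SchwartzMap.seminorm ℂ k l (Φ x)) m)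
    (T : 𝓢(Rd d, ℂ) →L[ℂ] 𝓢(Rd d, ℂ)) (k l : ℕ) :
    Integrable (fun x => SchwartzMap.seminorm ℂ k l (T (Φ x))) m  := by
  have hq : Continuous ((SchwartzMap.seminorm ℂ k l).comp T.toLinearMap : Seminorm ℂ _) :=
    ((schwartz_withSeminorms ℂ (Rd d) ℂ).continuous_seminorm (k, l)).comp T.continuous
  exact integrable_seminorm hΦ hΦint hq

variable [SecondCountableTopology X]

lemma integrable_map {Φ : X → 𝓢(Rd d, ℂ)} (hΦ : Continuous Φ)
    (hΦint : ∀ k l, Integrable (fun x => SchwartzMap.seminorm ℂ k l (Φ x)) m)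
    {E : Type*} [NormedAddCommGroup E] [NormedSpace ℂ E] (L : 𝓢(Rd d, ℂ) →L[ℂ] E) :
    Integrable (fun x => L (Φ x)) m := by
  let q : Seminorm ℂ 𝓢(Rd d, ℂ) := (normSeminorm ℂ E).comp L.toLinearMap
  have hq : Continuous q := continuous_norm.comp L.continuous
  exact (integrable_seminorm hΦ hΦint hq).mono' (L.continuous.comp hΦ).aestronglyMeasurable
    (.of_forall fun x => le_rfl)

/-- The evaluation of Schwartz functions at a point, as a continuous linear map. -/
def evalAtCLM (y : Rd d) : 𝓢(Rd d, ℂ) →L[ℂ] ℂ :=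
  (BoundedContinuousFunction.evalCLM ℂ y).comp
    (SchwartzMap.toBoundedContinuousFunctionCLM ℂ (Rd d) ℂ)

lemma evalAtCLM_apply (y : Rd d) (φ : 𝓢(Rd d, ℂ)) : evalAtCLM y φ = φ y := rfl

/-- Differentiation under the integral along the line y + t v. The supremum of |∂_v (Φ x)| is a
seminorm of Φ x, hence an integrable majorant. -/
lemma lineDerivOp_eq_integral {Φ : X → 𝓢(Rd d, ℂ)} (hΦ : Continuous Φ)
    (hΦint : ∀ k l, Integrable (fun x => SchwartzMap.seminorm ℂ k l (Φ x)) m)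
    {θ : 𝓢(Rd d, ℂ)} (hθ : ∀ y, θ y = ∫ x, Φ x y ∂m) (v y : Rd d) :
    (∂_{v} θ) y = ∫ x, (∂_{v} (Φ x)) y ∂m := by
  have e : (θ : Rd d → ℂ) = fun y => ∫ x, Φ x y ∂m := funext hθ
  have h2 : ∀ (φ : 𝓢(Rd d, ℂ)) (t : ℝ), HasDerivAt (fun t : ℝ => φ (y + t • v))
      ((∂_{v} φ) (y + t • v)) t := fun φ t => by
    have h3 : HasDerivAt (fun t : ℝ => y + t • v) v t := by
      simpa using ((hasDerivAt_id t).smul_const v).const_add y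
    exact (φ.hasFDerivAt (y + t • v)).comp_hasDerivAt t h3
  have hL := fun y => integrable_map hΦ hΦint (evalAtCLM y)
  have hL' := integrable_map ((lineDerivOpCLM ℂ 𝓢(Rd d, ℂ) v).continuous.comp hΦ)
    (integrable_seminorm_map hΦ hΦint (lineDerivOpCLM ℂ 𝓢(Rd d, ℂ) v)) (evalAtCLM y)
  have hb := integrable_seminorm_map hΦ hΦint (lineDerivOpCLM ℂ 𝓢(Rd d, ℂ) v) 0 0
  have h4 := (hasDerivAt_integral_of_dominated_loc_of_deriv_le (μ := m) (𝕜 := ℝ)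
    (F := fun t x => Φ x (y + t • v)) (F' := fun t x => (∂_{v} (Φ x)) (y + t • v)) (x₀ := 0)
    (s := Set.univ) Filter.univ_mem (.of_forall fun t => (hL _).1) (hL _)
    (by simpa [evalAtCLM_apply] using hL'.1)
    (.of_forall fun x t _ => SchwartzMap.norm_le_seminorm ℂ _ _) hb
    (.of_forall fun x t _ => h2 (Φ x) t)).2
  have h5 := h2 θ 0
  simp only [e] at h5
  simpa using h5.unique h4

lemma iteratedLineDerivOp_eq_integral {l : ℕ} (v : Fin l → Rd d) {Φ : X → 𝓢(Rd d, ℂ)}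
    (hΦ : Continuous Φ) (hΦint : ∀ k l, Integrable (fun x => SchwartzMap.seminorm ℂ k l (Φ x)) m)
    {θ : 𝓢(Rd d, ℂ)} (hθ : ∀ y, θ y = ∫ x, Φ x y ∂m) (y : Rd d) :
    (∂^{v} θ) y = ∫ x, (∂^{v} (Φ x)) y ∂m := by
  induction l generalizing Φ θ with
  | zero => simpa using hθ y
  | succ l ih =>
    -- The innermost derivative is split off, so that the induction hypothesis applies to the
    -- differentiated family.
    simp only [iteratedLineDerivOp_succ_right]
    exact ih _ ((lineDerivOpCLM ℂ 𝓢(Rd d, ℂ) (v (Fin.last l))).continuous.comp hΦ)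
      (integrable_seminorm_map hΦ hΦint (lineDerivOpCLM ℂ 𝓢(Rd d, ℂ) (v (Fin.last l))))
      (lineDerivOp_eq_integral hΦ hΦint hθ (v (Fin.last l)))

/-- A continuous linear map on Schwartz functions commutes with absolutely convergent integrals. -/
theorem map_eq_integral_of_forall_eval {E : Type*} [NormedAddCommGroup E] [NormedSpace ℂ E]
    [CompleteSpace E] (L : 𝓢(Rd d, ℂ) →L[ℂ] E) {Φ : X → 𝓢(Rd d, ℂ)} (hΦ : Continuous Φ)
    (hΦint : ∀ k l, Integrable (fun x => SchwartzMap.seminorm ℂ k l (Φ x)) m)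
    {θ : 𝓢(Rd d, ℂ)} (hθ : ∀ y, θ y = ∫ x, Φ x y ∂m) : L θ = ∫ x, L (Φ x) ∂m := by
  let q : Seminorm ℂ 𝓢(Rd d, ℂ) := (normSeminorm ℂ E).comp L.toLinearMap
  have hq : Continuous q := continuous_norm.comp L.continuous
  obtain ⟨s₀, C, -, hC⟩ := Seminorm.bound_of_continuous (schwartz_withSeminorms ℂ (Rd d) ℂ) q hq
  -- The index (0, 0) is added to make `J` injective.
  let s := insert (0, 0) s₀
  -- Schwartz space is not normed, so the family is mapped to a Banach space in which a Bochner
  -- integral makes sense and whose norm still controls `L`.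
  let J : 𝓢(Rd d, ℂ) →L[ℂ] ((i : s) → (JetDomain d i.1.2 →ᵇ ℂ)) :=
    ContinuousLinearMap.pi fun i => jetCLM i.1.1 i.1.2
  have hJle : ∀ φ, ‖L φ‖ ≤ C * ‖J φ‖ := by
    intro φ
    have h1 : q φ ≤ C * s₀.sup (schwartzSeminormFamily ℂ (Rd d) ℂ) φ := hC φ
    refine h1.trans ?_
    gcongr
    refine Seminorm.finset_sup_apply_le (norm_nonneg _) fun i hi => ?_
    have hi' : i ∈ s := Finset.mem_insert_of_mem hi
    refine le_trans ?_ (norm_le_pi_norm (J φ) ⟨i, hi'⟩)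
    exact (norm_jetCLM i.1 i.2 φ).ge
  have hJint : Integrable (fun x => J (Φ x)) m := integrable_map hΦ hΦint J
  have hLint : Integrable (fun x => L (Φ x)) m := integrable_map hΦ hΦint L
  have hJθ : J θ = ∫ x, J (Φ x) ∂m := by
    funext i
    ext1 z
    let ev := (BoundedContinuousFunction.evalCLM ℂ z).comp
      (ContinuousLinearMap.proj (R := ℂ) (φ := fun i : s => (JetDomain d i.1.2 →ᵇ ℂ)) i)
    have h1 : ev (∫ x, J (Φ x) ∂m) = ∫ x, ev (J (Φ x)) ∂m :=
      (ev.integral_comp_comm hJint).symm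
    have h2 : ∀ φ, ev (J φ) = ((‖z.1‖ ^ i.1.1 : ℝ) : ℂ) * ∂^{fun i => (z.2 i : Rd d)} φ z.1 :=
      fun φ => jetCLM_apply _ _ φ z
    change ev (J θ) = ev (∫ x, J (Φ x) ∂m)
    rw [h1]
    simp only [h2]
    rw [integral_const_mul, iteratedLineDerivOp_eq_integral _ hΦ hΦint hθ]
  have hJinj : Function.Injective J := by
    intro φ ψ h
    ext y
    have h1 := congrArg (fun v => v ⟨(0, 0), Finset.mem_insert_self _ _⟩ (y, 0)) h
    simpa [J, jetCLM_apply] using h1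
  let e := LinearEquiv.ofInjective J.toLinearMap hJinj
  -- `L` factors through the range of `J`, but only functionals extend by Hahn–Banach; hence the
  -- reduction to ℓ ∘ L.
  rw [SeparatingDual.eq_iff_forall_dual_eq (R := ℂ)]
  intro ℓ
  let g : StrongDual ℂ (LinearMap.range J.toLinearMap) :=
    LinearMap.mkContinuous ((ℓ.toLinearMap ∘ₗ L.toLinearMap) ∘ₗ e.symm.toLinearMap) (‖ℓ‖ * C) (by
      intro v
      obtain ⟨φ, rfl⟩ := e.surjective v
      simp only [LinearMap.comp_apply, LinearEquiv.coe_coe, LinearEquiv.symm_apply_apply]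
      refine (ℓ.le_opNorm _).trans ?_
      rw [mul_assoc]
      exact mul_le_mul_of_nonneg_left (hJle φ) (norm_nonneg _))
  obtain ⟨G, hG, -⟩ := exists_extension_norm_eq _ g
  have hGJ : ∀ φ, G (J φ) = ℓ (L φ) := by
    intro φ
    refine (hG (e φ)).trans ?_
    change ℓ (L (e.symm (e φ))) = ℓ (L φ)
    rw [e.symm_apply_apply]
  rw [← hGJ, hJθ, ← G.integral_comp_comm hJint, ← ℓ.integral_comp_comm hLint]
  simp only [hGJ]

end Interchange

/-! ### Translations, modulations and convolutions of Schwartz functions -/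

section Shifts

variable {d : ℕ}

/-- The translation operator `φ ↦ φ (· - z)`. -/
abbrev translate (z : Rd d) : 𝓢(Rd d, ℂ) →L[ℂ] 𝓢(Rd d, ℂ) := SchwartzMap.compSubConstCLM ℂ z

/-- The modulation operator `φ ↦ e^{2πi y·ξ} φ y`. -/
def modulate (ξ : Rd d) : 𝓢(Rd d, ℂ) →L[ℂ] 𝓢(Rd d, ℂ) :=
  SchwartzMap.smulLeftCLM ℂ (character (-ξ))

lemma modulate_apply (ξ y : Rd d) (φ : 𝓢(Rd d, ℂ)) :
    modulate ξ φ y = character (-ξ) y * φ y := by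
  simp [modulate, SchwartzMap.smulLeftCLM_apply_apply (hasTemperateGrowth_character (-ξ))]

lemma norm_character (ξ y : Rd d) : ‖character ξ y‖ = 1 := by
  simp [character, Complex.norm_exp]

lemma character_add_left (ξ η y : Rd d) :
    character (ξ + η) y = character ξ y * character η y := by
  rw [character, character, character, ← Complex.exp_add, inner_add_right]
  push_cast; ring_nf

lemma character_add_right (ξ x y : Rd d) :
    character ξ (x + y) = character ξ x * character ξ y := by
  rw [character, character, character, ← Complex.exp_add, inner_add_left]
  push_cast; ring_nf

lemma character_comm (ξ y : Rd d) : character ξ y = character y ξ := by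
  rw [character, character, real_inner_comm]

lemma character_neg_neg (ξ y : Rd d) : character (-ξ) (-y) = character ξ y := by
  simp [character]

lemma modulate_add (ξ η : Rd d) (φ : 𝓢(Rd d, ℂ)) :
    modulate (ξ + η) φ = modulate ξ (modulate η φ) := by
  ext y
  simp only [modulate_apply, neg_add, character_add_left, mul_assoc]

@[simp] lemma modulate_zero (φ : 𝓢(Rd d, ℂ)) : modulate 0 φ = φ := by
  ext y
  simp [modulate_apply, character]

lemma fourier_eq_integral_character (φ : 𝓢(Rd d, ℂ)) (η : Rd d) :
    𝓕 φ η = ∫ y, character η y * φ y := by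
  rw [SchwartzMap.fourier_coe, Real.fourier_eq']
  refine integral_congr_ae (.of_forall fun y => ?_)
  simp only [character, smul_eq_mul]
  congr 2
  push_cast; ring

lemma fourierInv_eq_integral_character (φ : 𝓢(Rd d, ℂ)) (η : Rd d) :
    𝓕⁻ φ η = ∫ y, character (-η) y * φ y := by
  rw [SchwartzMap.fourierInv_coe, Real.fourierInv_eq']
  refine integral_congr_ae (.of_forall fun y => ?_)
  simp only [character, smul_eq_mul, inner_neg_right]
  congr 2
  push_cast; ring

lemma fourier_modulate (ξ : Rd d) (φ : 𝓢(Rd d, ℂ)) : 𝓕 (modulate ξ φ) = translate ξ (𝓕 φ) := by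
  ext η
  rw [SchwartzMap.compSubConstCLM_apply, fourier_eq_integral_character,
    fourier_eq_integral_character]
  refine integral_congr_ae (.of_forall fun y => ?_)
  simp only [modulate_apply, sub_eq_add_neg η, character_add_left, mul_assoc]

lemma iteratedFDeriv_translate (l : ℕ) (z : Rd d) (φ : 𝓢(Rd d, ℂ)) (y : Rd d) :
    iteratedFDeriv ℝ l (translate z φ) y = iteratedFDeriv ℝ l φ (y - z) := by
  have e : (translate z φ : Rd d → ℂ) = fun y => φ (y - z) := rfl
  rw [e, iteratedFDeriv_comp_sub]

lemma exists_one_add_pow_mul_iteratedFDeriv_le (k l : ℕ) (φ : 𝓢(Rd d, ℂ)) :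
    ∃ C : ℝ, 0 ≤ C ∧ ∀ i ≤ l, ∀ y, (1 + ‖y‖) ^ k * ‖iteratedFDeriv ℝ i φ y‖ ≤ C :=
  ⟨2 ^ k * (Finset.Iic (k, l)).sup (fun m => SchwartzMap.seminorm ℂ m.1 m.2) φ, by positivity,
    fun _ hi y => SchwartzMap.one_add_le_sup_seminorm_apply (m := (k, l)) le_rfl hi φ y⟩

lemma one_add_norm_le_mul (y z : Rd d) : 1 + ‖y‖ ≤ (1 + ‖z‖) * (1 + ‖y - z‖) := by
  have h : ‖y‖ ≤ ‖y - z‖ + ‖z‖ := by simpa using norm_add_le (y - z) z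
  nlinarith [norm_nonneg z, norm_nonneg (y - z)]

lemma exists_seminorm_translate_le (k l : ℕ) (φ : 𝓢(Rd d, ℂ)) :
    ∃ C : ℝ, 0 ≤ C ∧ ∀ z, SchwartzMap.seminorm ℂ k l (translate z φ) ≤ C * (1 + ‖z‖) ^ k := by
  obtain ⟨C, hC, h⟩ := exists_one_add_pow_mul_iteratedFDeriv_le k l φ
  refine ⟨C, hC, fun z => SchwartzMap.seminorm_le_bound ℂ k l _ (by positivity) fun y => ?_⟩
  rw [iteratedFDeriv_translate]
  calc ‖y‖ ^ k * ‖iteratedFDeriv ℝ l φ (y - z)‖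
      ≤ ((1 + ‖z‖) * (1 + ‖y - z‖)) ^ k * ‖iteratedFDeriv ℝ l φ (y - z)‖ := by
        gcongr
        linarith [one_add_norm_le_mul y z]
    _ = ((1 + ‖y - z‖) ^ k * ‖iteratedFDeriv ℝ l φ (y - z)‖) * (1 + ‖z‖) ^ k := by
        rw [mul_pow]; ring
    _ ≤ _ := by gcongr; exact h l le_rfl _

/-- At z = 0 the mean value theorem bounds the increment of the l-th derivative by the derivative of
order l + 1; other points follow from the group law of translations. -/
lemma continuous_translate (φ : 𝓢(Rd d, ℂ)) : Continuous fun z => translate z φ := by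
  have key : Filter.Tendsto (fun z => translate z φ) (nhds 0) (nhds φ) := by
    rw [(schwartz_withSeminorms ℂ (Rd d) ℂ).tendsto_nhds]
    rintro ⟨k, l⟩ ε hε
    obtain ⟨C, hC, hb⟩ := exists_one_add_pow_mul_iteratedFDeriv_le k (l + 1) φ
    have hb' : ∀ z : Rd d, ‖z‖ ≤ 1 →
        SchwartzMap.seminorm ℂ k l (translate z φ - φ) ≤ 2 ^ k * C * ‖z‖ := by
      intro z hz
      refine SchwartzMap.seminorm_le_bound ℂ k l _ (by positivity) fun y => ?_
      have e : iteratedFDeriv ℝ l (translate z φ - φ : 𝓢(Rd d, ℂ)) y =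
          iteratedFDeriv ℝ l φ (y - z) - iteratedFDeriv ℝ l φ y := by
        rw [← iteratedFDeriv_translate]
        exact iteratedFDeriv_sub_apply ((translate z φ).contDiffAt l) (φ.contDiffAt l)
      rw [e]
      have hmv : ‖iteratedFDeriv ℝ l φ (y - z) - iteratedFDeriv ℝ l φ y‖ ≤
          (2 ^ k * C / (1 + ‖y‖) ^ k) * ‖(y - z) - y‖ := by
        refine Convex.norm_image_sub_le_of_norm_fderiv_le (𝕜 := ℝ)
          (s := Metric.closedBall y 1) (fun w _ => ?_) (fun w hw => ?_) (convex_closedBall y 1)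
          (Metric.mem_closedBall_self zero_le_one) (by simpa using hz)
        · exact ((φ.smooth ⊤).differentiable_iteratedFDeriv (mod_cast ENat.natCast_lt_top l)) w
        · rw [norm_fderiv_iteratedFDeriv, le_div_iff₀ (by positivity)]
          -- On the unit ball around y the weights at w and y are comparable; this is the origin of
          -- the factor 2 ^ k.
          have hyw : 1 + ‖y‖ ≤ 2 * (1 + ‖w‖) := by
            have h1 := norm_add_le (y - w) w
            have h2 : ‖y - w‖ ≤ 1 := by
              rw [← dist_eq_norm, dist_comm]; exact hw
            rw [sub_add_cancel] at h1
            linarith [norm_nonneg w]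
          calc _ ≤ ‖iteratedFDeriv ℝ (l + 1) φ w‖ * (2 * (1 + ‖w‖)) ^ k := by gcongr
            _ = 2 ^ k * ((1 + ‖w‖) ^ k * ‖iteratedFDeriv ℝ (l + 1) φ w‖) := by
                rw [mul_pow]; ring
            _ ≤ _ := by gcongr; exact hb _ le_rfl w
      have hz' : ‖(y - z) - y‖ = ‖z‖ := by simp
      rw [hz'] at hmv
      calc _ ≤ (1 + ‖y‖) ^ k * ((2 ^ k * C / (1 + ‖y‖) ^ k) * ‖z‖) := by
            gcongr; linarith
        _ = _ := by field_simp
    have hlim : Filter.Tendsto (fun z : Rd d => 2 ^ k * C * ‖z‖) (nhds 0) (nhds 0) := by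
      have : Continuous fun z : Rd d => 2 ^ k * C * ‖z‖ := by fun_prop
      simpa using this.tendsto 0
    filter_upwards [hlim.eventually_lt_const hε, Metric.closedBall_mem_nhds (0 : Rd d) one_pos]
      with z hz hz1
    exact (hb' z (by simpa using hz1)).trans_lt hz
  rw [continuous_iff_continuousAt]
  intro z₀
  have h1 : Filter.Tendsto (fun z => z - z₀) (nhds z₀) (nhds 0) := by
    have : Continuous fun z : Rd d => z - z₀ := by fun_prop
    simpa using this.tendsto z₀
  have h2 := ((translate z₀).continuous.tendsto φ).comp (key.comp h1)
  refine h2.congr fun z => ?_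
  ext y
  simp [SchwartzMap.compSubConstCLM_apply]

/-- The Fourier transform conjugates modulations to translations. -/
lemma continuous_modulate (φ : 𝓢(Rd d, ℂ)) : Continuous fun ξ => modulate ξ φ := by
  have h := (fourierInvCLM ℂ 𝓢(Rd d, ℂ)).continuous.comp (continuous_translate (𝓕 φ))
  refine h.congr fun ξ => ?_
  simp [← fourier_modulate]

/-! #### Convolutions -/

lemma fourier_schwartzConv (a b : 𝓢(Rd d, ℂ)) :
    𝓕 (schwartzConv a b) = SchwartzMap.pairing (ContinuousLinearMap.mul ℂ ℂ) (𝓕 a) (𝓕 b) :=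
  SchwartzMap.fourier_convolution _ a b

/-- Identities between convolutions are checked after a Fourier transform, where they become
identities between products. -/
lemma fourier_injective {a b : 𝓢(Rd d, ℂ)} (h : 𝓕 a = 𝓕 b) : a = b := by
  have := congrArg 𝓕⁻ h
  simpa using this

lemma schwartzConv_comm (a b : 𝓢(Rd d, ℂ)) : schwartzConv a b = schwartzConv b a := by
  refine fourier_injective ?_
  rw [fourier_schwartzConv, fourier_schwartzConv]
  ext y
  simp [mul_comm]

lemma schwartzConv_assoc (a b c : 𝓢(Rd d, ℂ)) :
    schwartzConv (schwartzConv a b) c = schwartzConv a (schwartzConv b c) := by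
  refine fourier_injective ?_
  rw [fourier_schwartzConv, fourier_schwartzConv, fourier_schwartzConv, fourier_schwartzConv]
  ext y
  simp [mul_assoc]

lemma modulate_schwartzConv (ξ : Rd d) (a b : 𝓢(Rd d, ℂ)) :
    modulate ξ (schwartzConv a b) = schwartzConv (modulate ξ a) (modulate ξ b) := by
  refine fourier_injective ?_
  rw [fourier_modulate, fourier_schwartzConv, fourier_schwartzConv, fourier_modulate,
    fourier_modulate]
  ext y
  simp [SchwartzMap.compSubConstCLM_apply]

lemma translate_schwartzConv (z : Rd d) (a b : 𝓢(Rd d, ℂ)) :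
    translate z (schwartzConv a b) = schwartzConv a (translate z b) := by
  ext y
  simp only [SchwartzMap.compSubConstCLM_apply, schwartzConv_apply]
  refine integral_congr_ae (.of_forall fun w => ?_)
  simp only [sub_right_comm]

lemma integrable_one_add_pow_mul (k : ℕ) (b : 𝓢(Rd d, ℂ)) :
    Integrable fun w : Rd d => (1 + ‖w‖) ^ k * ‖b w‖ := by
  have h1 : Integrable fun w : Rd d => 2 ^ (k - 1) * (‖b w‖ + ‖w‖ ^ k * ‖b w‖) :=
    (b.integrable.norm.add (b.integrable_pow_mul volume k)).const_mul _
  refine h1.mono' (by fun_prop) (.of_forall fun w => ?_)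
  rw [Real.norm_of_nonneg (by positivity)]
  calc (1 + ‖w‖) ^ k * ‖b w‖ ≤ (2 ^ (k - 1) * (1 ^ k + ‖w‖ ^ k)) * ‖b w‖ := by
        gcongr; exact add_pow_le zero_le_one (norm_nonneg w) k
    _ = _ := by ring

variable {E : Type*} [NormedAddCommGroup E] [NormedSpace ℂ E] [CompleteSpace E]

/-- A continuous linear map applied to a convolution of Schwartz functions. -/
lemma map_schwartzConv (L : 𝓢(Rd d, ℂ) →L[ℂ] E) (a b : 𝓢(Rd d, ℂ)) :
    L (schwartzConv a b) = ∫ w, b w • L (translate w a) := by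
  have h := map_eq_integral_of_forall_eval (m := volume) L
    (Φ := fun w => b w • translate w a) (θ := schwartzConv a b)
    (b.continuous.smul (continuous_translate a)) (fun k l => ?_) (fun y => ?_)
  · simpa using h
  · obtain ⟨C, hC, hb⟩ := exists_seminorm_translate_le k l a
    refine ((integrable_one_add_pow_mul k b).const_mul C).mono' ?_ (.of_forall fun w => ?_)
    · exact (((schwartz_withSeminorms ℂ (Rd d) ℂ).continuous_seminorm (k, l)).comp
        (b.continuous.smul (continuous_translate a))).aestronglyMeasurable
    · rw [Real.norm_of_nonneg (apply_nonneg _ _), map_smul_eq_mul]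
      calc _ ≤ ‖b w‖ * (C * (1 + ‖w‖) ^ k) := by gcongr; exact hb w
        _ = _ := by ring
  · rw [schwartzConv_comm, schwartzConv_apply]
    rfl

lemma continuous_finset_sup_seminorm {ι : Type*} {p : ι → Seminorm ℂ 𝓢(Rd d, ℂ)} {s : Finset ι}
    (h : ∀ i ∈ s, Continuous (p i)) : Continuous (s.sup p : Seminorm ℂ 𝓢(Rd d, ℂ)) :=
  Finset.sup_induction (p := fun q : Seminorm ℂ 𝓢(Rd d, ℂ) => Continuous q) continuous_const
    (fun _ ha _ hb => ha.sup hb) h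

/-- Decay of the product of two Schwartz functions when one of them is translated. -/
lemma exists_seminorm_pairing_translate_le (a : 𝓢(Rd d, ℂ)) (k l M : ℕ) :
    ∃ q : Seminorm ℂ 𝓢(Rd d, ℂ), Continuous q ∧ ∀ b ξ,
      (1 + ‖ξ‖) ^ M * SchwartzMap.seminorm ℂ k l
        (SchwartzMap.pairing (ContinuousLinearMap.mul ℂ ℂ) b (translate ξ a)) ≤ q b := by
  obtain ⟨C, hC, ha⟩ := exists_one_add_pow_mul_iteratedFDeriv_le M l a
  let S : Seminorm ℂ 𝓢(Rd d, ℂ) :=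
    (Finset.Iic (k + M, l)).sup (fun m => SchwartzMap.seminorm ℂ m.1 m.2)
  let c : ℝ≥0 := ⟨2 ^ l * C * 2 ^ (k + M), by positivity⟩
  have hS : Continuous S :=
    continuous_finset_sup_seminorm fun i _ =>
      (schwartz_withSeminorms ℂ (Rd d) ℂ).continuous_seminorm i
  refine ⟨c • S, hS.const_smul c, fun b ξ => ?_⟩
  have hb : ∀ i ≤ l, ∀ y, (1 + ‖y‖) ^ (k + M) * ‖iteratedFDeriv ℝ i b y‖ ≤ 2 ^ (k + M) * S b :=
    fun i hi y => SchwartzMap.one_add_le_sup_seminorm_apply (m := (k + M, l)) le_rfl hi b y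
  have hSb : 0 ≤ S b := apply_nonneg _ _
  rw [mul_comm, ← le_div_iff₀ (by positivity)]
  refine SchwartzMap.seminorm_le_bound ℂ k l _ (by positivity) fun y => ?_
  rw [le_div_iff₀ (by positivity)]
  have e : (SchwartzMap.pairing (ContinuousLinearMap.mul ℂ ℂ) b (translate ξ a) : Rd d → ℂ) =
      fun y => b y * translate ξ a y := by
    funext y; simp
  rw [e]
  have hmul := norm_iteratedFDeriv_mul_le (n := l) (b.smooth ⊤) ((translate ξ a).smooth ⊤) y
    (mod_cast le_top)
  calc _ ≤ ‖y‖ ^ k * (∑ i ∈ Finset.range (l + 1), (l.choose i : ℝ) *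
        ‖iteratedFDeriv ℝ i b y‖ * ‖iteratedFDeriv ℝ (l - i) (translate ξ a) y‖) *
          (1 + ‖ξ‖) ^ M := by gcongr
    _ = ∑ i ∈ Finset.range (l + 1), (l.choose i : ℝ) * (‖y‖ ^ k * (1 + ‖ξ‖) ^ M *
        (‖iteratedFDeriv ℝ i b y‖ * ‖iteratedFDeriv ℝ (l - i) (translate ξ a) y‖)) := by
        rw [Finset.mul_sum, Finset.sum_mul]
        refine Finset.sum_congr rfl fun i _ => by ring
    _ ≤ ∑ i ∈ Finset.range (l + 1), (l.choose i : ℝ) * (2 ^ (k + M) * S b * C) := by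
        refine Finset.sum_le_sum fun i hi => ?_
        refine mul_le_mul_of_nonneg_left ?_ (by positivity)
        rw [iteratedFDeriv_translate]
        -- One factor is absorbed by the decay of b, which raises its weight exponent from k to k +
        -- M, the other by the decay of a.
        have h1 : 1 + ‖ξ‖ ≤ (1 + ‖y‖) * (1 + ‖y - ξ‖) := by
          have := one_add_norm_le_mul ξ y
          rwa [norm_sub_rev] at this
        calc _ ≤ (1 + ‖y‖) ^ k * ((1 + ‖y‖) * (1 + ‖y - ξ‖)) ^ M *
              (‖iteratedFDeriv ℝ i b y‖ * ‖iteratedFDeriv ℝ (l - i) a (y - ξ)‖) := by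
              gcongr; linarith
          _ = ((1 + ‖y‖) ^ (k + M) * ‖iteratedFDeriv ℝ i b y‖) *
              ((1 + ‖y - ξ‖) ^ M * ‖iteratedFDeriv ℝ (l - i) a (y - ξ)‖) := by
              rw [mul_pow, pow_add]; ring
          _ ≤ _ := mul_le_mul (hb i (by simpa [Nat.lt_succ_iff] using hi) y)
              (ha _ (Nat.sub_le l i) _) (by positivity) (by positivity)
    _ = 2 ^ l * (2 ^ (k + M) * S b * C) := by
        rw [← Finset.sum_mul]
        congr 1
        exact_mod_cast Nat.sum_range_choose l
    _ = 2 ^ l * C * 2 ^ (k + M) * S b := by ring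

/-- The reproducing formula `κ 0 • θ = ∫ θ * M_ξ κ dξ`. -/
lemma smul_map_eq_integral_modulate (L : 𝓢(Rd d, ℂ) →L[ℂ] E) (θ κ : 𝓢(Rd d, ℂ)) :
    κ 0 • L θ = ∫ ξ, L (schwartzConv θ (modulate ξ κ)) := by
  let P : Rd d → 𝓢(Rd d, ℂ) := fun ξ =>
    SchwartzMap.pairing (ContinuousLinearMap.mul ℂ ℂ) (𝓕 θ) (translate ξ (𝓕 κ))
  have hP : Continuous P :=
    (SchwartzMap.pairing (ContinuousLinearMap.mul ℂ ℂ) (𝓕 θ)).continuous.comp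
      (continuous_translate (𝓕 κ))
  -- On the Fourier side the formula reads 𝓕θ(y) ∫ 𝓕κ(y - ξ) dξ = κ(0) 𝓕θ(y).
  have hκ : κ 0 = ∫ w, 𝓕 κ w := by
    have h1 : 𝓕⁻ (𝓕 κ) = κ := by simp
    rw [← h1, fourierInv_eq_integral_character]
    simp [character]
  have h := map_eq_integral_of_forall_eval (m := volume) (L ∘L fourierInvCLM ℂ 𝓢(Rd d, ℂ))
    (Φ := P) (θ := κ 0 • 𝓕 θ) hP (fun k l => ?_) (fun y => ?_)
  · have h2 : ∀ ξ, 𝓕⁻ (P ξ) = schwartzConv θ (modulate ξ κ) := fun ξ => by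
      refine fourier_injective ?_
      rw [fourier_schwartzConv, fourier_modulate]
      simp [P]
    simpa [h2] using h
  · obtain ⟨q, -, hq⟩ := exists_seminorm_pairing_translate_le (𝓕 κ) k l (d + 1)
    have h1 : Integrable fun ξ : Rd d => q (𝓕 θ) * (1 + ‖ξ‖) ^ (-((d + 1 : ℕ) : ℝ)) :=
      (integrable_one_add_norm (by simp)).const_mul _
    refine h1.mono' ((((schwartz_withSeminorms ℂ (Rd d) ℂ).continuous_seminorm (k, l)).comp
      hP).aestronglyMeasurable) (.of_forall fun ξ => ?_)
    rw [Real.norm_of_nonneg (apply_nonneg _ _), Real.rpow_neg (by positivity), Real.rpow_natCast,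
      ← div_eq_mul_inv, le_div_iff₀ (by positivity), mul_comm]
    exact hq (𝓕 θ) ξ
  · have h1 : ∀ ξ, P ξ y = 𝓕 θ y * 𝓕 κ (y - ξ) := fun ξ => by simp [P]
    simp only [h1]
    rw [integral_const_mul, integral_sub_left_eq_self (fun w => 𝓕 κ w) volume y, ← hκ]
    simp [mul_comm]

/-- Decay of `ψ * M_ξ γ`. -/
lemma exists_norm_schwartzConv_modulate_le (γ : 𝓢(Rd d, ℂ)) (M : ℕ) :
    ∃ q : Seminorm ℂ 𝓢(Rd d, ℂ), Continuous q ∧ ∀ ψ ξ z,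
      (1 + ‖z‖) ^ M * ((1 + ‖ξ‖) ^ M * ‖schwartzConv ψ (modulate ξ γ) z‖) ≤ q ψ := by
  let S : Seminorm ℂ 𝓢(Rd d, ℂ) :=
    ((Finset.Iic (M, 0)).sup (fun m => SchwartzMap.seminorm ℂ m.1 m.2)).comp
      (fourierInvCLM ℂ 𝓢(Rd d, ℂ)).toLinearMap
  have hS : Continuous S :=
    (continuous_finset_sup_seminorm fun i _ =>
      (schwartz_withSeminorms ℂ (Rd d) ℂ).continuous_seminorm i).comp
      (fourierInvCLM ℂ 𝓢(Rd d, ℂ)).continuous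
  obtain ⟨s, C, -, hC⟩ := Seminorm.bound_of_continuous (schwartz_withSeminorms ℂ (Rd d) ℂ) S hS
  choose q hqc hq using fun i : ℕ × ℕ => exists_seminorm_pairing_translate_le (𝓕 γ) i.1 i.2 M
  let Q : Seminorm ℂ 𝓢(Rd d, ℂ) := s.sup q
  have hQ : Continuous Q := continuous_finset_sup_seminorm fun i _ => hqc i
  let c : ℝ≥0 := 2 ^ M * C
  let Q' : Seminorm ℂ 𝓢(Rd d, ℂ) := Q.comp (fourierCLM ℂ 𝓢(Rd d, ℂ)).toLinearMap
  have hQ' : Continuous Q' := hQ.comp (fourierCLM ℂ 𝓢(Rd d, ℂ)).continuous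
  refine ⟨c • Q', hQ'.const_smul c, fun ψ ξ z => ?_⟩
  -- ψ * M_ξ γ is the inverse Fourier transform of the product of 𝓕ψ with the translate of 𝓕γ by ξ.
  -- That product has small seminorms for large ξ, and continuity of 𝓕⁻ converts them into decay in
  -- z.
  set G := SchwartzMap.pairing (ContinuousLinearMap.mul ℂ ℂ) (𝓕 ψ) (translate ξ (𝓕 γ)) with hG
  have e : schwartzConv ψ (modulate ξ γ) = 𝓕⁻ G := by
    refine fourier_injective ?_
    rw [fourier_schwartzConv, fourier_modulate]
    simp [hG]
  have h1 : (1 + ‖z‖) ^ M * ‖schwartzConv ψ (modulate ξ γ) z‖ ≤ 2 ^ M * S G := by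
    have := SchwartzMap.one_add_le_sup_seminorm_apply (𝕜 := ℂ) (m := (M, 0)) le_rfl le_rfl
      (schwartzConv ψ (modulate ξ γ)) z
    rw [norm_iteratedFDeriv_zero] at this
    refine this.trans_eq ?_
    rw [e]; rfl
  have h2 : (1 + ‖ξ‖) ^ M * s.sup (schwartzSeminormFamily ℂ (Rd d) ℂ) G ≤ Q' ψ := by
    rw [mul_comm, ← le_div_iff₀ (by positivity)]
    refine Seminorm.finset_sup_apply_le (by positivity) fun i hi => ?_
    rw [le_div_iff₀ (by positivity), mul_comm]
    exact (hq i (𝓕 ψ) ξ).trans (Seminorm.le_finset_sup_apply hi)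
  calc _ = (1 + ‖ξ‖) ^ M * ((1 + ‖z‖) ^ M * ‖schwartzConv ψ (modulate ξ γ) z‖) := by ring
    _ ≤ (1 + ‖ξ‖) ^ M * (2 ^ M * (C * s.sup (schwartzSeminormFamily ℂ (Rd d) ℂ) G)) := by
        refine mul_le_mul_of_nonneg_left (h1.trans ?_) (by positivity)
        exact mul_le_mul_of_nonneg_left (hC G) (by positivity)
    _ = 2 ^ M * C * ((1 + ‖ξ‖) ^ M * s.sup (schwartzSeminormFamily ℂ (Rd d) ℂ) G) := by ring
    _ ≤ 2 ^ M * C * Q' ψ := by gcongr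

end Shifts

/-! ### Smoothings of tempered distributions and change of the window -/

section Smoothing

variable {d : ℕ} {E : Type*} [NormedAddCommGroup E] [NormedSpace ℂ E]

/-- The map `φ ↦ (f * φ) x`. -/
def smoothingCLM (f : 𝓢'(Rd d, E)) (x : Rd d) : 𝓢(Rd d, ℂ) →L[ℂ] E :=
  (f : 𝓢(Rd d, ℂ) →L[ℂ] E) ∘L reflectAt x

lemma smoothingCLM_apply (f : 𝓢'(Rd d, E)) (x : Rd d) (φ : 𝓢(Rd d, ℂ)) :
    smoothingCLM f x φ = smoothing f φ x := rfl

lemma smoothing_translate (f : 𝓢'(Rd d, E)) (w : Rd d) (φ : 𝓢(Rd d, ℂ)) (x : Rd d) :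
    smoothing f (translate w φ) x = smoothing f φ (x - w) := by
  unfold smoothing
  congr 1
  ext y
  simp only [reflectAt_apply, SchwartzMap.compSubConstCLM_apply]
  congr 1; abel

lemma continuous_smoothing (f : 𝓢'(Rd d, E)) (φ : 𝓢(Rd d, ℂ)) : Continuous (smoothing f φ) := by
  have h := (smoothingCLM f 0).continuous.comp ((continuous_translate φ).comp continuous_neg)
  refine h.congr fun x => ?_
  simp [smoothingCLM_apply, smoothing_translate]

lemma continuous_smoothing_modulate (f : 𝓢'(Rd d, E)) (φ : 𝓢(Rd d, ℂ)) (x : Rd d) :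
    Continuous fun ξ => smoothing f (modulate ξ φ) x :=
  (smoothingCLM f x).continuous.comp (continuous_modulate φ)

/-- Separate continuity in x and ξ suffices for joint strong measurability. -/
lemma stronglyMeasurable_smoothing_modulate (f : 𝓢'(Rd d, E)) (φ : 𝓢(Rd d, ℂ)) :
    StronglyMeasurable (Function.uncurry fun x ξ => smoothing f (modulate ξ φ) x) :=
  stronglyMeasurable_uncurry_of_continuous_of_stronglyMeasurable
    (fun ξ => continuous_smoothing f (modulate ξ φ))
    fun x => (continuous_smoothing_modulate f φ x).stronglyMeasurable

lemma smoothing_schwartzConv [CompleteSpace E] (f : 𝓢'(Rd d, E)) (a b : 𝓢(Rd d, ℂ)) (x : Rd d) :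
    smoothing f (schwartzConv a b) x = ∫ w, b w • smoothing f a (x - w) := by
  rw [← smoothingCLM_apply, map_schwartzConv]
  simp only [smoothingCLM_apply, smoothing_translate]

lemma enorm_smoothing_schwartzConv_le [CompleteSpace E] (f : 𝓢'(Rd d, E)) (a b : 𝓢(Rd d, ℂ))
    (x : Rd d) :
    ‖smoothing f (schwartzConv a b) x‖ₑ ≤ ∫⁻ w, ‖b w‖ₑ * ‖smoothing f a (x - w)‖ₑ := by
  rw [smoothing_schwartzConv]
  refine (enorm_integral_le_lintegral_enorm _).trans_eq ?_
  simp only [enorm_smul]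

/-- The absolute value of the short-time Fourier transform, as a function of the window `γ` with
respect to which `f` is smoothed. -/
def amplitude (f : 𝓢'(Rd d, E)) (γ : 𝓢(Rd d, ℂ)) (x ξ : Rd d) : ℝ≥0∞ :=
  ‖smoothing f (modulate ξ γ) x‖ₑ

lemma measurable_amplitude (f : 𝓢'(Rd d, E)) (γ : 𝓢(Rd d, ℂ)) :
    Measurable (Function.uncurry (amplitude f γ)) :=
  (stronglyMeasurable_smoothing_modulate f γ).enorm

lemma measurable_amplitude_slice (f : 𝓢'(Rd d, E)) (γ : 𝓢(Rd d, ℂ)) (ξ : Rd d) :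
    Measurable fun x => amplitude f γ x ξ :=
  (continuous_smoothing f (modulate ξ γ)).enorm.measurable

/-- The involution `g ↦ conj (g (-·))`. -/
def involution (g : 𝓢(Rd d, ℂ)) : 𝓢(Rd d, ℂ) :=
  SchwartzMap.postcompCLM (𝕜 := ℝ) (Complex.conjCLE : ℂ →L[ℝ] ℂ) (reflectAt 0 g)

lemma involution_apply (g : 𝓢(Rd d, ℂ)) (y : Rd d) :
    involution g y = (starRingEnd ℂ) (g (-y)) := by
  simp [involution, reflectAt_apply]

lemma involution_ne_zero {g : 𝓢(Rd d, ℂ)} (hg : g ≠ 0) : involution g ≠ 0 := by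
  contrapose! hg
  ext y
  have := DFunLike.congr_fun hg (-y)
  simpa [involution_apply] using this

/-- The value at 0 is ‖γ‖₂². Hence γ * γ~ is an admissible κ in the reproducing formula. -/
lemma schwartzConv_involution_zero_ne_zero {γ : 𝓢(Rd d, ℂ)} (hγ : γ ≠ 0) :
    schwartzConv γ (involution γ) 0 ≠ 0 := by
  have h1 : schwartzConv γ (involution γ) 0 = ((∫ y, ‖γ y‖ ^ 2 : ℝ) : ℂ) := by
    rw [schwartzConv_apply, ← integral_complex_ofReal]
    refine integral_congr_ae (.of_forall fun y => ?_)
    simp [involution_apply, Complex.mul_conj, Complex.normSq_eq_norm_sq]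
  rw [h1]
  have hc : Continuous fun y => ‖γ y‖ ^ 2 := by fun_prop
  have hΦint : Integrable fun y => ‖γ y‖ ^ 2 := by
    have := (γ.memLp 2 volume).integrable_norm_pow (by norm_num)
    simpa using this
  have hpos : 0 < ∫ y, ‖γ y‖ ^ 2 := by
    rw [integral_pos_iff_support_of_nonneg (fun y => by positivity) hΦint]
    refine (hc.isOpen_support).measure_pos volume ?_
    obtain ⟨y, hy⟩ : ∃ y, γ y ≠ 0 := by
      by_contra! h
      exact hγ (by ext y; simpa using h y)
    exact ⟨y, by simpa using hy⟩
  exact_mod_cast hpos.ne'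

lemma schwartzConv_modulate_modulate (η ξ : Rd d) (ψ γ : 𝓢(Rd d, ℂ)) :
    schwartzConv (modulate η ψ) (modulate ξ γ) =
      modulate η (schwartzConv ψ (modulate (ξ - η) γ)) := by
  rw [modulate_schwartzConv, ← modulate_add, add_sub_cancel]

lemma ofReal_le_mul_weight {c t : ℝ} {M : ℕ} {z ξ : Rd d}
    (h : (1 + ‖z‖) ^ M * ((1 + ‖ξ‖) ^ M * t) ≤ c) (hc : 0 ≤ c) :
    ENNReal.ofReal t ≤ ENNReal.ofReal c * (weight (-(M : ℝ)) z * weight (-(M : ℝ)) ξ) := by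
  have hz := bracket_pos z
  have hξ := bracket_pos ξ
  rw [weight, weight, ← ENNReal.ofReal_mul (by positivity), ← ENNReal.ofReal_mul hc]
  refine ENNReal.ofReal_le_ofReal ?_
  rw [Real.rpow_neg hz.le, Real.rpow_neg hξ.le, Real.rpow_natCast, Real.rpow_natCast,
    ← mul_inv, ← div_eq_mul_inv, le_div_iff₀ (by positivity)]
  rcases le_total t 0 with ht | ht
  · exact (mul_nonpos_of_nonpos_of_nonneg ht (by positivity)).trans hc
  · refine le_trans ?_ h
    calc t * (bracket z ^ M * bracket ξ ^ M) ≤ t * ((1 + ‖z‖) ^ M * (1 + ‖ξ‖) ^ M) := by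
          gcongr <;> exact bracket_le_one_add_norm _
      _ = _ := by ring

lemma exists_enorm_schwartzConv_modulate_le (γ : 𝓢(Rd d, ℂ)) (M : ℕ) :
    ∃ q : Seminorm ℂ 𝓢(Rd d, ℂ), Continuous q ∧ ∀ ψ ξ z,
      ‖schwartzConv ψ (modulate ξ γ) z‖ₑ ≤
        ENNReal.ofReal (q ψ) * (weight (-(M : ℝ)) z * weight (-(M : ℝ)) ξ) := by
  obtain ⟨q, hqc, hq⟩ := exists_norm_schwartzConv_modulate_le γ M
  refine ⟨q, hqc, fun ψ ξ z => ?_⟩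
  rw [← ofReal_norm]
  exact ofReal_le_mul_weight (hq ψ ξ z) (apply_nonneg _ _)

/-- With κ = γ * γ~, the reproducing formula expands κ(0) f * M_η ψ as the integral over ξ of (f *
M_ξ γ) * M_η(ψ * M_(ξ-η) γ~), and the last factor decays rapidly in position and in ξ - η. The
constant depends only on γ, ψ and M. -/
lemma exists_convDominated_amplitude {γ : 𝓢(Rd d, ℂ)} (hγ : γ ≠ 0) (ψ : 𝓢(Rd d, ℂ)) (M : ℕ) :
    ∃ C : ℝ≥0, ∀ (E : Type*) [NormedAddCommGroup E] [NormedSpace ℂ E] [CompleteSpace E]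
      (f : 𝓢'(Rd d, E)), ConvDominated C M (amplitude f γ) (amplitude f ψ) := by
  obtain ⟨q, -, hq⟩ := exists_enorm_schwartzConv_modulate_le (involution γ) M
  set κ := schwartzConv γ (involution γ) with hκ
  have hκ0 : κ 0 ≠ 0 := schwartzConv_involution_zero_ne_zero hγ
  refine ⟨‖κ 0‖₊⁻¹ * (q ψ).toNNReal, fun E _ _ _ f x η => ?_⟩
  have hne : ‖κ 0‖₊ ≠ 0 := by simpa using hκ0
  have hr := smul_map_eq_integral_modulate (smoothingCLM f x) (modulate η ψ) κ
  have e : ∀ ξ, schwartzConv (modulate η ψ) (modulate ξ κ) =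
      schwartzConv (modulate ξ γ)
        (modulate η (schwartzConv ψ (modulate (ξ - η) (involution γ)))) := fun ξ => by
    rw [← schwartzConv_modulate_modulate, hκ, modulate_schwartzConv,
      ← schwartzConv_assoc, ← schwartzConv_assoc, schwartzConv_comm (modulate η ψ)]
  have h1 : ‖κ 0‖ₑ * amplitude f ψ x η ≤ ∫⁻ ξ, ∫⁻ w,
      ENNReal.ofReal (q ψ) * (weight (-(M : ℝ)) w * weight (-(M : ℝ)) (ξ - η)) *
        amplitude f γ (x - w) ξ := by
    rw [amplitude, ← enorm_smul, ← smoothingCLM_apply, hr]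
    refine (enorm_integral_le_lintegral_enorm _).trans (lintegral_mono fun ξ => ?_)
    rw [e, smoothingCLM_apply]
    refine (enorm_smoothing_schwartzConv_le f _ _ x).trans (lintegral_mono fun w => ?_)
    refine mul_le_mul' ?_ le_rfl
    rw [modulate_apply, enorm_mul]
    have : ‖character (-η) w‖ₑ = 1 := by
      rw [← ofReal_norm, norm_character]; simp
    rw [this, one_mul]
    exact hq ψ (ξ - η) w
  have h2 : ∫⁻ ξ, ∫⁻ w,
      ENNReal.ofReal (q ψ) * (weight (-(M : ℝ)) w * weight (-(M : ℝ)) (ξ - η)) *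
        amplitude f γ (x - w) ξ = ENNReal.ofReal (q ψ) *
      ∫⁻ ξ, (∫⁻ z, amplitude f γ (x - z) (η - ξ) * weight (-(M : ℝ)) z) * weight (-(M : ℝ)) ξ := by
    rw [← lintegral_sub_left_eq_self _ η, ← lintegral_const_mul' _ _ ENNReal.ofReal_ne_top]
    refine lintegral_congr fun ξ => ?_
    rw [← lintegral_mul_const' _ _ (weight_ne_top _ _),
      ← lintegral_const_mul' _ _ ENNReal.ofReal_ne_top]
    refine lintegral_congr fun w => ?_
    rw [sub_sub_cancel_left, weight_neg_arg]
    ring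
  rw [h2] at h1
  have h3 : amplitude f ψ x η = ((‖κ 0‖₊⁻¹ : ℝ≥0) : ℝ≥0∞) * (‖κ 0‖ₑ * amplitude f ψ x η) := by
    rw [← mul_assoc, enorm_eq_nnnorm, ← ENNReal.coe_mul, inv_mul_cancel₀ hne, ENNReal.coe_one,
      one_mul]
  rw [h3, ENNReal.coe_mul, mul_assoc]
  exact mul_le_mul' le_rfl h1

/-- Norms with respect to different windows are comparable. -/
theorem exists_mixedNorm_amplitude_le {γ : 𝓢(Rd d, ℂ)} (hγ : γ ≠ 0) (ψ : 𝓢(Rd d, ℂ))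
    {p q : ℝ≥0∞} (hp : 1 ≤ p) (hq : 1 ≤ q) (r s : ℝ) :
    ∃ C : ℝ≥0, ∀ (E : Type*) [NormedAddCommGroup E] [NormedSpace ℂ E] [CompleteSpace E]
      (f : 𝓢'(Rd d, E)),
      mixedNorm p q r s (amplitude f ψ) ≤ C * mixedNorm p q r s (amplitude f γ) := by
  -- This M makes the Peetre constants of both weights finite.
  obtain ⟨M, hM⟩ := exists_nat_gt (d + |r| + |s|)
  obtain ⟨C, hC⟩ := exists_convDominated_amplitude hγ ψ M
  have h1 : peetreConst d r M < ∞ := peetreConst_lt_top (by linarith [abs_nonneg s])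
  have h2 : peetreConst d s M < ∞ := peetreConst_lt_top (by linarith [abs_nonneg r])
  refine ⟨C * (peetreConst d r M).toNNReal * (peetreConst d s M).toNNReal, fun E _ _ _ f => ?_⟩
  have h := (hC E f).mixedNorm_le (r := r) (s := s) (measurable_amplitude f γ) hp hq
  rwa [ENNReal.coe_mul, ENNReal.coe_mul, ENNReal.coe_toNNReal h1.ne, ENNReal.coe_toNNReal h2.ne]

/-- Finiteness for one window bounds the smoothings with every window at every frequency; this is
applied to u with p = 1. -/
lemma exists_slice_le [CompleteSpace E] {γ : 𝓢(Rd d, ℂ)} (hγ : γ ≠ 0) (ψ : 𝓢(Rd d, ℂ))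
    {p q : ℝ≥0∞} (hp : 1 ≤ p) (hq : 1 ≤ q) (r s : ℝ) {f : 𝓢'(Rd d, E)}
    (hf : mixedNorm p q r s (amplitude f γ) < ∞) :
    ∃ C : ℝ≥0, ∀ η, eLpNorm (fun x => weight r x * amplitude f ψ x η) p volume ≤
      C * weight (-s) η := by
  obtain ⟨M, hM⟩ := exists_nat_gt (d + |r| + |s|)
  obtain ⟨C, hC⟩ := exists_convDominated_amplitude hγ ψ M
  have h1 : peetreConst d r M < ∞ := peetreConst_lt_top (by linarith [abs_nonneg s])
  have h2 : peetreConst d s M < ∞ := peetreConst_lt_top (by linarith [abs_nonneg r])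
  have hfin : C * peetreConst d r M * peetreConst d s M * mixedNorm p q r s (amplitude f γ) ≠ ∞ :=
    ENNReal.mul_ne_top (ENNReal.mul_ne_top (ENNReal.mul_ne_top ENNReal.coe_ne_top h1.ne) h2.ne) hf.ne
  refine ⟨(C * peetreConst d r M * peetreConst d s M * mixedNorm p q r s (amplitude f γ)).toNNReal,
    fun η => ?_⟩
  have h := (hC E f).slice_le (r := r) (s := s) (measurable_amplitude f γ) hp hq
    (by linarith [abs_nonneg r]) η
  rw [ENNReal.coe_toNNReal hfin]
  calc _ = weight (-s) η * (weight s η *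
          eLpNorm (fun x => weight r x * amplitude f ψ x η) p volume) := by
          rw [← mul_assoc, mul_comm (weight (-s) η), weight_mul_weight_neg, one_mul]
      _ ≤ weight (-s) η * _ := mul_le_mul' le_rfl h
      _ = _ := mul_comm _ _

/-- The analogue for f, where bounds at every position are needed as well. -/
lemma exists_pointwise_le [CompleteSpace E] {γ : 𝓢(Rd d, ℂ)} (hγ : γ ≠ 0) (ψ : 𝓢(Rd d, ℂ))
    {p q : ℝ≥0∞} (hp : 1 ≤ p) (hq : 1 ≤ q) (r s : ℝ) {f : 𝓢'(Rd d, E)}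
    (hf : mixedNorm p q r s (amplitude f γ) < ∞) :
    ∃ C : ℝ≥0, ∀ x η, amplitude f ψ x η ≤ C * (weight (-r) x * weight (-s) η) := by
  obtain ⟨M, hM⟩ := exists_nat_gt (d + |r| + |s|)
  obtain ⟨C, hC⟩ := exists_convDominated_amplitude hγ ψ M
  have h1 : peetreConst d r M < ∞ := peetreConst_lt_top (by linarith [abs_nonneg s])
  have h2 : peetreConst d s M < ∞ := peetreConst_lt_top (by linarith [abs_nonneg r])
  have hfin : C * peetreConst d r M * peetreConst d s M * mixedNorm p q r s (amplitude f γ) ≠ ∞ :=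
    ENNReal.mul_ne_top (ENNReal.mul_ne_top (ENNReal.mul_ne_top ENNReal.coe_ne_top h1.ne) h2.ne) hf.ne
  refine ⟨(C * peetreConst d r M * peetreConst d s M * mixedNorm p q r s (amplitude f γ)).toNNReal,
    fun x η => ?_⟩
  have h := (hC E f).pointwise_le (r := r) (s := s) (measurable_amplitude f γ) hp hq
    (by linarith [abs_nonneg s]) (by linarith [abs_nonneg r]) x η
  rw [ENNReal.coe_toNNReal hfin]
  calc amplitude f ψ x η = (weight r x * weight (-r) x) * (weight s η * weight (-s) η) *
          amplitude f ψ x η := by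
          rw [weight_mul_weight_neg, weight_mul_weight_neg, one_mul, one_mul]
      _ = weight (-r) x * weight (-s) η * (weight r x * (weight s η * amplitude f ψ x η)) := by ring
      _ ≤ weight (-r) x * weight (-s) η * _ := mul_le_mul' le_rfl h
      _ = _ := mul_comm _ _

/-! #### The norms of modulation and amalgam spaces -/

lemma reflectAt_modulate_involution (g : 𝓢(Rd d, ℂ)) (x ξ : Rd d) :
    reflectAt x (modulate ξ (involution g)) = character (-ξ) x • conjShift g x ξ := by
  ext y
  rw [reflectAt_apply, modulate_apply, involution_apply, neg_sub, sub_eq_add_neg x y,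
    character_add_right, character_neg_neg]
  have : (character (-ξ) x • conjShift g x ξ) y = character (-ξ) x * conjShift g x ξ y := rfl
  rw [this, conjShift_apply, mul_assoc]
  rfl

lemma amplitude_involution (f : 𝓢'(Rd d, E)) (g : 𝓢(Rd d, ℂ)) (x ξ : Rd d) :
    amplitude f (involution g) x ξ = ‖stft g f x ξ‖ₑ := by
  rw [amplitude, smoothing, reflectAt_modulate_involution, map_smul, enorm_smul,
    ← ofReal_norm (character (-ξ) x), norm_character]
  simp [stft]

lemma enorm_bracket_rpow_mul_norm {F : Type*} [NormedAddCommGroup F] (r : ℝ) (x : Rd d) (v : F) :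
    ‖bracket x ^ r * ‖v‖‖ₑ = weight r x * ‖v‖ₑ := by
  rw [enorm_mul, enorm_norm, weight, Real.enorm_of_nonneg (Real.rpow_nonneg (bracket_pos x).le _)]

lemma modulationNorm_eq (g : 𝓢(Rd d, ℂ)) (p q : ℝ≥0∞) (r s : ℝ) (f : 𝓢'(Rd d, E)) :
    modulationNorm g p q r s f = mixedNorm p q r s (amplitude f (involution g)) := by
  unfold modulationNorm mixedNorm
  congr 1
  funext ξ
  congr 1
  refine eLpNorm_congr_enorm_ae (.of_forall fun x => ?_)
  rw [enorm_bracket_rpow_mul_norm, amplitude_involution, enorm_eq_self]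

/-- The window on the Fourier side. -/
def dualWindow (g : 𝓢(Rd d, ℂ)) : 𝓢(Rd d, ℂ) :=
  𝓕⁻ (SchwartzMap.postcompCLM (𝕜 := ℝ) (Complex.conjCLE : ℂ →L[ℝ] ℂ) g)

lemma dualWindow_ne_zero {g : 𝓢(Rd d, ℂ)} (hg : g ≠ 0) : dualWindow g ≠ 0 := by
  contrapose! hg
  have h1 : 𝓕 (dualWindow g) = 𝓕 (0 : 𝓢(Rd d, ℂ)) := congrArg 𝓕 hg
  ext y
  have h2 : 𝓕 (dualWindow g) y = (starRingEnd ℂ) (g y) := by simp [dualWindow]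
  have h3 : 𝓕 (0 : 𝓢(Rd d, ℂ)) = 0 := map_zero (fourierCLM ℂ 𝓢(Rd d, ℂ))
  rw [h1, h3] at h2
  simpa using h2.symm

/-- Smoothing 𝓕⁻μ with the dual window modulated by x, evaluated at t, yields V_g μ(x, -t). This
exchange of position and frequency turns amalgam norms of μ into modulation norms of 𝓕⁻μ. -/
lemma fourierInv_reflectAt_modulate (g : 𝓢(Rd d, ℂ)) (x t : Rd d) :
    𝓕⁻ (reflectAt t (modulate x (dualWindow g))) = conjShift g x (-t) := by
  ext η
  have h1 : ∀ y, 𝓕 (dualWindow g) y = (starRingEnd ℂ) (g y) := fun y => by simp [dualWindow]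
  rw [conjShift_apply, ← h1, fourierInv_eq_integral_character, fourier_eq_integral_character,
    ← integral_sub_left_eq_self _ volume t, ← integral_const_mul]
  refine integral_congr_ae (.of_forall fun y => ?_)
  simp only [reflectAt_apply, sub_sub_cancel, modulate_apply]
  rw [sub_eq_add_neg t y, character_add_right, character_neg_neg, sub_eq_add_neg η x,
    character_add_left, character_comm (-η), ← character_neg_neg t, neg_neg]
  have : Complex.exp (-(2 * Real.pi * Complex.I) * (inner ℝ η (-t) : ℝ)) = character (-t) η := rfl
  rw [this]
  ring

lemma smoothing_fourierInv_modulate (μ : 𝓢'(Rd d, E)) (g : 𝓢(Rd d, ℂ)) (x t : Rd d) :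
    smoothing (𝓕⁻ μ) (modulate x (dualWindow g)) t = stft g μ x (-t) := by
  rw [smoothing, TemperedDistribution.fourierInv_apply, fourierInv_reflectAt_modulate, stft]

lemma eLpNorm_comp_neg {a : Rd d → ℝ≥0∞} (ha : Measurable a) (p : ℝ≥0∞) :
    eLpNorm (fun z => a (-z)) p volume = eLpNorm a p volume :=
  eLpNorm_comp_measurePreserving ha.aestronglyMeasurable (Measure.measurePreserving_neg volume)

lemma amalgamNorm_eq (g : 𝓢(Rd d, ℂ)) (p q : ℝ≥0∞) (r s : ℝ) (μ : 𝓢'(Rd d, E)) :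
    amalgamNorm g p q r s μ = mixedNorm p q r s (amplitude (𝓕⁻ μ) (dualWindow g)) := by
  have h := smoothing_fourierInv_modulate μ g
  generalize (𝓕⁻ μ) = u at h ⊢
  have hx : ∀ x, eLpNorm (fun ξ : Rd d => bracket ξ ^ r * ‖stft g μ x ξ‖) p volume =
      eLpNorm (fun t => weight r t * amplitude u (dualWindow g) t x) p volume := by
    intro x
    have hm : Measurable fun t => weight r t * amplitude u (dualWindow g) t x :=
      (measurable_weight r).mul (measurable_amplitude_slice u (dualWindow g) x)
    rw [← eLpNorm_comp_neg hm]
    refine eLpNorm_congr_enorm_ae (.of_forall fun t => ?_)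
    rw [enorm_bracket_rpow_mul_norm, enorm_eq_self, amplitude, h, neg_neg, weight_neg_arg]
  simp only [amalgamNorm, hx]
  rfl

end Smoothing

/-! ### Existence of the convolution -/

section Existence

variable {d : ℕ} {E₀ E₁ E₂ : Type*}
  [NormedAddCommGroup E₀] [NormedSpace ℂ E₀]
  [NormedAddCommGroup E₁] [NormedSpace ℂ E₁]
  [NormedAddCommGroup E₂] [NormedSpace ℂ E₂]
  {B : E₀ →L[ℂ] E₁ →L[ℂ] E₂} {u : 𝓢'(Rd d, E₀)} {f : 𝓢'(Rd d, E₁)} {r s δ : ℝ}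

lemma enorm_bilin_le (hB : ‖B‖ ≤ 1) (v : E₀) (w : E₁) : ‖B v w‖ₑ ≤ ‖v‖ₑ * ‖w‖ₑ := by
  rw [← ofReal_norm, ← ofReal_norm, ← ofReal_norm, ← ENNReal.ofReal_mul (norm_nonneg _)]
  refine ENNReal.ofReal_le_ofReal ((B.le_opNorm₂ v w).trans ?_)
  gcongr
  exact mul_le_of_le_one_left (norm_nonneg _) hB

lemma weight_sub_le (r : ℝ) (x y : Rd d) :
    weight r (x - y) ≤ ENNReal.ofReal (2 ^ |r|) * (weight r x * weight |r| y) := by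
  have := weight_add_arg_le r x (-y)
  rwa [weight_neg_arg, ← sub_eq_add_neg] at this

/-- Substitution y ↦ x - y and Peetre's inequality for the exponent -r. It makes convolution of a
function in L¹ with weight ⟨x⟩^|r| with one of size ⟨x⟩^(-r) absolutely convergent. -/
lemma lintegral_mul_weight_neg_le (A : Rd d → ℝ≥0∞) (r : ℝ) (x : Rd d) :
    ∫⁻ y, A (x - y) * weight (-r) y ≤
      ENNReal.ofReal (2 ^ |r|) * weight (-r) x * ∫⁻ y, weight |r| y * A y := by
  rw [← lintegral_sub_left_eq_self _ x, ← lintegral_const_mul'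
    _ _ (ENNReal.mul_ne_top ENNReal.ofReal_ne_top (weight_ne_top _ _))]
  refine lintegral_mono fun y => ?_
  have h := weight_sub_le (-r) x y
  rw [abs_neg] at h
  rw [sub_sub_cancel]
  calc A y * weight (-r) (x - y)
      ≤ A y * (ENNReal.ofReal (2 ^ |r|) * (weight (-r) x * weight |r| y)) := by gcongr
    _ = _ := by ring

/-- Integrability of all smoothings of `u` against the weight `⟨x⟩ ^ |r|`, with a polynomial bound
in the frequency variable. -/
def SmoothingsIntegrable (r δ : ℝ) (u : 𝓢'(Rd d, E₀)) : Prop :=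
  ∀ φ, ∃ C : ℝ≥0, ∀ η, ∫⁻ x, weight |r| x * amplitude u φ x η ≤ C * weight (-δ) η

/-- Boundedness of all smoothings of `f` by the weight `⟨x⟩ ^ (-r)`, with a polynomial bound in the
frequency variable. -/
def SmoothingsBounded (r s : ℝ) (f : 𝓢'(Rd d, E₁)) : Prop :=
  ∀ ψ, ∃ C : ℝ≥0, ∀ x η, amplitude f ψ x η ≤ C * (weight (-r) x * weight (-s) η)

lemma SmoothingsIntegrable.lintegral_lt_top (hu : SmoothingsIntegrable r δ u) (φ : 𝓢(Rd d, ℂ)) :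
    ∫⁻ x, weight |r| x * ‖smoothing u φ x‖ₑ < ∞ := by
  obtain ⟨C, hC⟩ := hu φ
  have h := hC 0
  simp only [amplitude, modulate_zero] at h
  exact h.trans_lt (ENNReal.mul_lt_top ENNReal.coe_lt_top (weight_ne_top _ _).lt_top)

lemma SmoothingsBounded.exists_le (hf : SmoothingsBounded r s f) (ψ : 𝓢(Rd d, ℂ)) :
    ∃ C : ℝ≥0, ∀ x, ‖smoothing f ψ x‖ₑ ≤ C * weight (-r) x := by
  obtain ⟨C, hC⟩ := hf ψ
  refine ⟨C * (weight (-s) (0 : Rd d)).toNNReal, fun x => ?_⟩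
  have h := hC x 0
  simp only [amplitude, modulate_zero] at h
  rw [ENNReal.coe_mul, ENNReal.coe_toNNReal (weight_ne_top _ _)]
  exact h.trans_eq (by ring)

lemma exists_enorm_le_weight (χ : 𝓢(Rd d, ℂ)) (M : ℕ) :
    ∃ C : ℝ≥0, ∀ w, ‖χ w‖ₑ ≤ C * weight (-(M : ℝ)) w := by
  obtain ⟨C, hC, h⟩ := exists_one_add_pow_mul_iteratedFDeriv_le M 0 χ
  refine ⟨C.toNNReal, fun w => ?_⟩
  have h1 := h 0 le_rfl w
  rw [norm_iteratedFDeriv_zero] at h1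
  have h2 := ofReal_le_mul_weight (M := M) (z := w) (ξ := 0) (t := ‖χ w‖) (c := C)
    (by simpa using h1) hC
  have h3 : weight (-(M : ℝ)) (0 : Rd d) = 1 := by simp [weight, bracket]
  rwa [h3, mul_one, ofReal_norm] at h2

lemma continuous_bilin_smoothing (x : Rd d) (φ ψ : 𝓢(Rd d, ℂ)) :
    Continuous fun y => B (smoothing u φ (x - y)) (smoothing f ψ y) :=
  (B.continuous.comp ((continuous_smoothing u φ).comp (continuous_const.sub continuous_id))).clm_apply
    (continuous_smoothing f ψ)

lemma integrable_bilin_smoothing (hB : ‖B‖ ≤ 1) (hu : SmoothingsIntegrable r δ u)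
    (hf : SmoothingsBounded r s f) (x : Rd d) (φ ψ : 𝓢(Rd d, ℂ)) :
    Integrable fun y => B (smoothing u φ (x - y)) (smoothing f ψ y) := by
  refine ⟨(continuous_bilin_smoothing x φ ψ).aestronglyMeasurable, ?_⟩
  obtain ⟨C, hC⟩ := hf.exists_le ψ
  calc ∫⁻ y, ‖B (smoothing u φ (x - y)) (smoothing f ψ y)‖ₑ
      ≤ ∫⁻ y, C * (‖smoothing u φ (x - y)‖ₑ * weight (-r) y) := by
        refine lintegral_mono fun y => (enorm_bilin_le hB _ _).trans ?_
        calc _ ≤ ‖smoothing u φ (x - y)‖ₑ * (C * weight (-r) y) := mul_le_mul' le_rfl (hC y)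
          _ = _ := by ring
    _ = C * ∫⁻ y, ‖smoothing u φ (x - y)‖ₑ * weight (-r) y :=
        lintegral_const_mul' _ _ ENNReal.coe_ne_top
    _ ≤ C * (ENNReal.ofReal (2 ^ |r|) * weight (-r) x *
        ∫⁻ y, weight |r| y * ‖smoothing u φ y‖ₑ) :=
        mul_le_mul' le_rfl (lintegral_mul_weight_neg_le _ r x)
    _ < ∞ := ENNReal.mul_lt_top ENNReal.coe_lt_top (ENNReal.mul_lt_top
        (ENNReal.mul_lt_top ENNReal.ofReal_lt_top (weight_ne_top _ _).lt_top)
        (hu.lintegral_lt_top φ))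

/-- A test function may be moved from one factor of a convolution to the other. -/
lemma integral_bilin_smoothing_comm [CompleteSpace E₂] (hB : ‖B‖ ≤ 1)
    (hu : SmoothingsIntegrable r δ u) (hf : SmoothingsBounded r s f) (x : Rd d)
    (a ψ χ : 𝓢(Rd d, ℂ)) :
    ∫ y, B (smoothing u a (x - y)) (smoothing f (schwartzConv ψ χ) y) =
      ∫ y, B (smoothing u (schwartzConv a χ) (x - y)) (smoothing f ψ y) := by
  have hl : ∀ y, B (smoothing u a (x - y)) (smoothing f (schwartzConv ψ χ) y) =
      ∫ w, χ w • B (smoothing u a (x - y)) (smoothing f ψ (y - w)) := fun y => by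
    have h := map_schwartzConv ((B (smoothing u a (x - y))) ∘L smoothingCLM f y) ψ χ
    simpa only [ContinuousLinearMap.comp_apply, smoothingCLM_apply, smoothing_translate] using h
  have hr : ∀ y, B (smoothing u (schwartzConv a χ) (x - y)) (smoothing f ψ y) =
      ∫ w, χ w • B (smoothing u a (x - y - w)) (smoothing f ψ y) := fun y => by
    have h := map_schwartzConv ((B.flip (smoothing f ψ y)) ∘L smoothingCLM u (x - y)) a χ
    simpa only [ContinuousLinearMap.comp_apply, smoothingCLM_apply, smoothing_translate,
      ContinuousLinearMap.flip_apply] using h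
  have hc : Continuous fun z : Rd d × Rd d =>
      χ z.2 • B (smoothing u a (x - z.1)) (smoothing f ψ (z.1 - z.2)) := by
    refine (χ.continuous.comp continuous_snd).smul (Continuous.clm_apply ?_ ?_)
    · exact B.continuous.comp
        ((continuous_smoothing u a).comp (continuous_const.sub continuous_fst))
    · exact (continuous_smoothing f ψ).comp (continuous_fst.sub continuous_snd)
  -- Absolute integrability in (y, w) justifies both exchanges of integrals below. The decay of χ of
  -- order M > d + |r| pays for Peetre's factor ⟨w⟩^|r| and for the integration in w.
  have hΦint : Integrable (Function.uncurry fun y w : Rd d =>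
      χ w • B (smoothing u a (x - y)) (smoothing f ψ (y - w))) (volume.prod volume) := by
    refine ⟨hc.aestronglyMeasurable, ?_⟩
    obtain ⟨C, hC⟩ := hf.exists_le ψ
    obtain ⟨M, hM⟩ := exists_nat_gt (d + |r|)
    obtain ⟨C', hC'⟩ := exists_enorm_le_weight χ M
    have hMi : ∫⁻ w : Rd d, weight (|r| - M) w < ∞ := by
      have := lintegral_weight_lt_top (d := d) (r := M - |r|) (by linarith)
      rwa [neg_sub] at this
    have hA : AEMeasurable fun y => ‖smoothing u a (x - y)‖ₑ * weight (-r) y :=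
      ((((continuous_smoothing u a).comp (continuous_const.sub continuous_id)).enorm.measurable).mul
        (measurable_weight _)).aemeasurable
    have hW : AEMeasurable fun w : Rd d => weight (|r| - M) w := (measurable_weight _).aemeasurable
    calc ∫⁻ z, ‖Function.uncurry (fun y w : Rd d =>
          χ w • B (smoothing u a (x - y)) (smoothing f ψ (y - w))) z‖ₑ ∂(volume.prod volume)
        ≤ ∫⁻ z : Rd d × Rd d, (C * C' * ENNReal.ofReal (2 ^ |r|)) *
          ((‖smoothing u a (x - z.1)‖ₑ * weight (-r) z.1) * weight (|r| - M) z.2)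
            ∂(volume.prod volume) := by
          refine lintegral_mono fun z => ?_
          simp only [Function.uncurry, enorm_smul]
          have h := weight_sub_le (-r) z.1 z.2
          rw [abs_neg] at h
          calc _ ≤ (C' * weight (-(M : ℝ)) z.2) * (‖smoothing u a (x - z.1)‖ₑ *
                (C * (ENNReal.ofReal (2 ^ |r|) * (weight (-r) z.1 * weight |r| z.2)))) :=
                mul_le_mul' (hC' _) ((enorm_bilin_le hB _ _).trans (mul_le_mul' le_rfl
                  ((hC _).trans (mul_le_mul' le_rfl h))))
            _ = _ := by rw [sub_eq_add_neg |r|, weight_add]; ring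
      _ = (C * C' * ENNReal.ofReal (2 ^ |r|)) *
          ((∫⁻ y, ‖smoothing u a (x - y)‖ₑ * weight (-r) y) * ∫⁻ w : Rd d, weight (|r| - M) w) := by
          rw [lintegral_const_mul' _ _ (ENNReal.mul_ne_top (ENNReal.mul_ne_top ENNReal.coe_ne_top
            ENNReal.coe_ne_top) ENNReal.ofReal_ne_top), lintegral_prod_mul hA hW]
      _ < ∞ := by
          refine ENNReal.mul_lt_top (ENNReal.mul_lt_top (ENNReal.mul_lt_top ENNReal.coe_lt_top
            ENNReal.coe_lt_top) ENNReal.ofReal_lt_top) (ENNReal.mul_lt_top ?_ hMi)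
          refine (lintegral_mul_weight_neg_le (fun y => ‖smoothing u a y‖ₑ) r x).trans_lt ?_
          exact ENNReal.mul_lt_top (ENNReal.mul_lt_top ENNReal.ofReal_lt_top
            (weight_ne_top _ _).lt_top) (hu.lintegral_lt_top a)
  simp only [hl, hr]
  rw [integral_integral_swap hΦint]
  -- The substitution y ↦ y + w moves the translation by w from f to u.
  have hshift : ∀ w, ∫ y, χ w • B (smoothing u a (x - y)) (smoothing f ψ (y - w)) =
      ∫ y, χ w • B (smoothing u a (x - y - w)) (smoothing f ψ y) := fun w => by
    rw [← integral_add_right_eq_self _ w]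
    simp only [add_sub_cancel_right, sub_add_eq_sub_sub]
  simp only [hshift]
  refine integral_integral_swap ?_
  -- The sheared integrand stays integrable because the shear preserves the product measure.
  have h := ((measurePreserving_add_prod (volume : Measure (Rd d)) (volume : Measure (Rd d))
    ).integrable_comp_of_integrable hΦint).swap
  refine h.congr (.of_forall fun z => ?_)
  simp only [Function.comp_apply, Function.uncurry, Prod.fst_swap, Prod.snd_swap,
    add_sub_cancel_right, sub_add_eq_sub_sub]

lemma schwartzConv_add_left (a b c : 𝓢(Rd d, ℂ)) :
    schwartzConv (a + b) c = schwartzConv a c + schwartzConv b c := by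
  simp [schwartzConv]

lemma schwartzConv_smul_left (t : ℂ) (a c : 𝓢(Rd d, ℂ)) :
    schwartzConv (t • a) c = t • schwartzConv a c := by
  simp [schwartzConv]

lemma continuous_schwartzConv_right (θ : 𝓢(Rd d, ℂ)) : Continuous fun b => schwartzConv θ b :=
  (SchwartzMap.convolution (ContinuousLinearMap.mul ℂ ℂ) θ).continuous

lemma stronglyMeasurable_smoothing_schwartzConv_modulate (f : 𝓢'(Rd d, E₁))
    (θ ρ : 𝓢(Rd d, ℂ)) :
    StronglyMeasurable fun z : Rd d × Rd d =>
      smoothing f (schwartzConv θ (modulate z.1 ρ)) z.2 :=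
  stronglyMeasurable_uncurry_of_continuous_of_stronglyMeasurable
    (u := fun ξ y => smoothing f (schwartzConv θ (modulate ξ ρ)) y)
    (fun y => (smoothingCLM f y).continuous.comp
      ((continuous_schwartzConv_right θ).comp (continuous_modulate ρ)))
    fun _ => (continuous_smoothing f _).stronglyMeasurable

lemma stronglyMeasurable_bilin {X : Type*} [MeasurableSpace X] {v : X → E₀} {w : X → E₁}
    (B : E₀ →L[ℂ] E₁ →L[ℂ] E₂) (hv : StronglyMeasurable v) (hw : StronglyMeasurable w) :
    StronglyMeasurable fun z => B (v z) (w z) :=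
  B.isBoundedBilinearMap.continuous.comp_stronglyMeasurable (hv.prodMk hw)

/-- The integrand of the distribution that represents the convolution. -/
def convIntegrand (B : E₀ →L[ℂ] E₁ →L[ℂ] E₂) (u : 𝓢'(Rd d, E₀)) (f : 𝓢'(Rd d, E₁))
    (a ρ θ : 𝓢(Rd d, ℂ)) (x : Rd d) (z : Rd d × Rd d) : E₂ :=
  B (smoothing u (modulate z.1 a) (x - z.2)) (smoothing f (schwartzConv θ (modulate z.1 ρ)) z.2)

lemma stronglyMeasurable_convIntegrand (a ρ θ : 𝓢(Rd d, ℂ)) (x : Rd d) :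
    StronglyMeasurable (convIntegrand B u f a ρ θ x) := by
  have h1 : StronglyMeasurable fun z : Rd d × Rd d => smoothing u (modulate z.1 a) (x - z.2) :=
    stronglyMeasurable_uncurry_of_continuous_of_stronglyMeasurable
      (u := fun ξ y => smoothing u (modulate ξ a) (x - y))
      (fun y => continuous_smoothing_modulate u a (x - y))
      fun _ => ((continuous_smoothing u _).comp
        (continuous_const.sub continuous_id)).stronglyMeasurable
  exact stronglyMeasurable_bilin B h1 (stronglyMeasurable_smoothing_schwartzConv_modulate f θ ρ)

/-- A window of the form c * b splits the tasks: θ * M_ξ(c * b) = M_ξ c * (θ * M_ξ b), where f * M_ξ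
c grows at most polynomially in ξ while θ * M_ξ b decays to any order, controlled by a seminorm of
θ. -/
lemma exists_smoothing_schwartzConv_modulate_le [CompleteSpace E₁]
    (hf : SmoothingsBounded r s f) (b c : 𝓢(Rd d, ℂ)) (N : ℝ) :
    ∃ q : Seminorm ℂ 𝓢(Rd d, ℂ), Continuous q ∧ ∃ C : ℝ≥0, ∀ θ ξ y,
      ‖smoothing f (schwartzConv θ (modulate ξ (schwartzConv c b))) y‖ₑ ≤
        ENNReal.ofReal (q θ) * C * (weight (-r) y * weight (-N) ξ) := by
  obtain ⟨M, hM⟩ := exists_nat_gt (d + |r| + |s| + |N|)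
  obtain ⟨q, hqc, hq⟩ := exists_enorm_schwartzConv_modulate_le b M
  obtain ⟨C, hC⟩ := hf c
  have hMi : ∫⁻ w : Rd d, weight (|r| - M) w < ∞ := by
    have := lintegral_weight_lt_top (d := d) (r := M - |r|)
      (by linarith [abs_nonneg s, abs_nonneg N])
    rwa [neg_sub] at this
  refine ⟨q, hqc, C * ((2 : ℝ) ^ |r|).toNNReal * (∫⁻ w : Rd d, weight (|r| - M) w).toNNReal,
    fun θ ξ y => ?_⟩
  have e : schwartzConv θ (modulate ξ (schwartzConv c b)) =
      schwartzConv (modulate ξ c) (schwartzConv θ (modulate ξ b)) := by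
    rw [modulate_schwartzConv, ← schwartzConv_assoc, ← schwartzConv_assoc, schwartzConv_comm θ]
  have hN : weight (-(M : ℝ)) ξ * weight (-s) ξ ≤ weight (-N) ξ := by
    rw [← weight_add]
    refine weight_le_weight ?_ ξ
    linarith [neg_abs_le s, le_abs_self N, abs_nonneg r]
  rw [e]
  calc _ ≤ ∫⁻ w, ‖schwartzConv θ (modulate ξ b) w‖ₑ * ‖smoothing f (modulate ξ c) (y - w)‖ₑ :=
        enorm_smoothing_schwartzConv_le f _ _ y
    _ ≤ ∫⁻ w, (ENNReal.ofReal (q θ) * C * ENNReal.ofReal (2 ^ |r|) *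
        (weight (-r) y * (weight (-(M : ℝ)) ξ * weight (-s) ξ))) * weight (|r| - M) w := by
        refine lintegral_mono fun w => ?_
        have h := weight_sub_le (-r) y w
        rw [abs_neg] at h
        calc _ ≤ (ENNReal.ofReal (q θ) * (weight (-(M : ℝ)) w * weight (-(M : ℝ)) ξ)) *
              (C * ((ENNReal.ofReal (2 ^ |r|) * (weight (-r) y * weight |r| w)) *
                weight (-s) ξ)) :=
              mul_le_mul' (hq θ ξ w) ((hC _ _).trans
                (mul_le_mul' le_rfl (mul_le_mul' h le_rfl)))
          _ = _ := by rw [sub_eq_add_neg |r|, weight_add |r|]; ring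
    _ = (ENNReal.ofReal (q θ) * C * ENNReal.ofReal (2 ^ |r|) *
        (weight (-r) y * (weight (-(M : ℝ)) ξ * weight (-s) ξ))) *
          ∫⁻ w : Rd d, weight (|r| - M) w := lintegral_const_mul _ (measurable_weight _)
    _ ≤ (ENNReal.ofReal (q θ) * C * ENNReal.ofReal (2 ^ |r|) * (weight (-r) y * weight (-N) ξ)) *
          ∫⁻ w : Rd d, weight (|r| - M) w :=
        mul_le_mul' (mul_le_mul' le_rfl (mul_le_mul' le_rfl hN)) le_rfl
    _ = _ := by
        rw [ENNReal.coe_mul, ENNReal.coe_mul, ENNReal.coe_toNNReal hMi.ne]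
        simp only [ENNReal.ofReal]
        ring

lemma exists_lintegral_convIntegrand_le [CompleteSpace E₁] (hB : ‖B‖ ≤ 1)
    (hu : SmoothingsIntegrable r δ u) (hf : SmoothingsBounded r s f) (a b c : 𝓢(Rd d, ℂ)) :
    ∃ q : Seminorm ℂ 𝓢(Rd d, ℂ), Continuous q ∧ ∃ C : ℝ≥0, ∀ θ x,
      ∫⁻ z, ‖convIntegrand B u f a (schwartzConv c b) θ x z‖ₑ ≤
        ENNReal.ofReal (q θ) * C * weight (-r) x := by
  -- The exponent |δ| compensates the possible growth of u * M_ξ a, and d + 1 remains for the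
  -- integration in ξ.
  obtain ⟨q, hqc, C, hC⟩ := exists_smoothing_schwartzConv_modulate_le hf b c (d + 1 + |δ|)
  obtain ⟨C', hC'⟩ := hu a
  have hI : ∫⁻ ξ : Rd d, weight (-(d + 1 : ℝ)) ξ < ∞ := lintegral_weight_lt_top (by linarith)
  refine ⟨q, hqc, C * C' * ((2 : ℝ) ^ |r|).toNNReal *
    (∫⁻ ξ : Rd d, weight (-(d + 1 : ℝ)) ξ).toNNReal, fun θ x => ?_⟩
  rw [Measure.volume_eq_prod, lintegral_prod _
    (stronglyMeasurable_convIntegrand _ _ _ _).enorm.aemeasurable]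
  have hin : ∀ ξ : Rd d, ∫⁻ y, ‖convIntegrand B u f a (schwartzConv c b) θ x (ξ, y)‖ₑ ≤
      (ENNReal.ofReal (q θ) * C * C' * ENNReal.ofReal (2 ^ |r|) * weight (-r) x) *
        weight (-(d + 1 : ℝ)) ξ := by
    intro ξ
    calc _ ≤ ∫⁻ y, (ENNReal.ofReal (q θ) * C * weight (-(d + 1 + |δ|)) ξ) *
          (amplitude u a (x - y) ξ * weight (-r) y) := by
          refine lintegral_mono fun y => (enorm_bilin_le hB _ _).trans ?_
          calc _ ≤ amplitude u a (x - y) ξ *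
                (ENNReal.ofReal (q θ) * C * (weight (-r) y * weight (-(d + 1 + |δ|)) ξ)) :=
                mul_le_mul' le_rfl (hC θ ξ y)
            _ = _ := by ring
      _ = (ENNReal.ofReal (q θ) * C * weight (-(d + 1 + |δ|)) ξ) *
          ∫⁻ y, amplitude u a (x - y) ξ * weight (-r) y :=
          lintegral_const_mul' _ _ (ENNReal.mul_ne_top (ENNReal.mul_ne_top ENNReal.ofReal_ne_top
            ENNReal.coe_ne_top) (weight_ne_top _ _))
      _ ≤ (ENNReal.ofReal (q θ) * C * weight (-(d + 1 + |δ|)) ξ) *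
          (ENNReal.ofReal (2 ^ |r|) * weight (-r) x * (C' * weight (-δ) ξ)) :=
          mul_le_mul' le_rfl ((lintegral_mul_weight_neg_le (fun y => amplitude u a y ξ) r x).trans
            (mul_le_mul' le_rfl (hC' ξ)))
      _ = (ENNReal.ofReal (q θ) * C * C' * ENNReal.ofReal (2 ^ |r|) * weight (-r) x) *
          (weight (-(d + 1 + |δ|)) ξ * weight (-δ) ξ) := by ring
      _ ≤ _ := by
          refine mul_le_mul' le_rfl ?_
          rw [← weight_add]
          exact weight_le_weight (by linarith [neg_abs_le δ]) ξ
  calc _ ≤ ∫⁻ ξ : Rd d,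
        (ENNReal.ofReal (q θ) * C * C' * ENNReal.ofReal (2 ^ |r|) * weight (-r) x) *
        weight (-(d + 1 : ℝ)) ξ := lintegral_mono hin
    _ = (ENNReal.ofReal (q θ) * C * C' * ENNReal.ofReal (2 ^ |r|) * weight (-r) x) *
        ∫⁻ ξ : Rd d, weight (-(d + 1 : ℝ)) ξ := lintegral_const_mul _ (measurable_weight _)
    _ = _ := by
        rw [ENNReal.coe_mul, ENNReal.coe_mul, ENNReal.coe_mul, ENNReal.coe_toNNReal hI.ne]
        simp only [ENNReal.ofReal]
        ring

lemma integrable_convIntegrand [CompleteSpace E₁] (hB : ‖B‖ ≤ 1)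
    (hu : SmoothingsIntegrable r δ u) (hf : SmoothingsBounded r s f) (a b c θ : 𝓢(Rd d, ℂ))
    (x : Rd d) : Integrable (convIntegrand B u f a (schwartzConv c b) θ x) := by
  obtain ⟨q, -, C, hC⟩ := exists_lintegral_convIntegrand_le hB hu hf a b c
  refine ⟨(stronglyMeasurable_convIntegrand _ _ _ _).aestronglyMeasurable, (hC θ x).trans_lt ?_⟩
  exact ENNReal.mul_lt_top (ENNReal.mul_lt_top ENNReal.ofReal_lt_top ENNReal.coe_lt_top)
    (weight_ne_top _ _).lt_top

/-- The distribution `θ ↦ ∫ convIntegrand`, which is a multiple of the convolution of `u` and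
`f`. -/
lemma exists_distribution [CompleteSpace E₁] (hB : ‖B‖ ≤ 1)
    (hu : SmoothingsIntegrable r δ u) (hf : SmoothingsBounded r s f) (a b c : 𝓢(Rd d, ℂ)) :
    ∃ h : 𝓢'(Rd d, E₂), ∀ θ x,
      smoothing h θ x = ∫ z, convIntegrand B u f a (schwartzConv c b) θ x z := by
  have hΦint := integrable_convIntegrand hB hu hf a b c
  obtain ⟨q, hqc, C, hC⟩ := exists_lintegral_convIntegrand_le hB hu hf a b c
  let q' : Seminorm ℂ 𝓢(Rd d, ℂ) := q.comp (reflectAt 0).toLinearMap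
  have hq' : Continuous q' := hqc.comp (reflectAt 0).continuous
  obtain ⟨t, C', -, hC'⟩ := Seminorm.bound_of_continuous (schwartz_withSeminorms ℂ (Rd d) ℂ) q' hq'
  let h : 𝓢(Rd d, ℂ) →L[ℂ] E₂ := SchwartzMap.mkCLMtoNormedSpace
    (fun θ => ∫ z, convIntegrand B u f a (schwartzConv c b) (reflectAt 0 θ) 0 z)
    (fun θ θ' => by
      rw [← integral_add (hΦint _ 0) (hΦint _ 0)]
      refine integral_congr_ae (.of_forall fun z => ?_)
      simp only [convIntegrand, map_add, schwartzConv_add_left, ← smoothingCLM_apply])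
    (fun k θ => by
      rw [RingHom.id_apply, ← integral_smul]
      refine integral_congr_ae (.of_forall fun z => ?_)
      simp only [convIntegrand, map_smul, schwartzConv_smul_left, ← smoothingCLM_apply])
    (by
      -- Continuity in θ is the bound of `exists_lintegral_convIntegrand_le` at x = 0, where the
      -- weight is 1.
      refine ⟨t, C * C', by positivity, fun θ => ?_⟩
      have h1 := (enorm_integral_le_lintegral_enorm
        (convIntegrand B u f a (schwartzConv c b) (reflectAt 0 θ) 0)).trans (hC (reflectAt 0 θ) 0)
      have h3 : weight (-r) (0 : Rd d) = 1 := by simp [weight, bracket]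
      rw [h3, mul_one, ← ofReal_norm, ← ENNReal.ofReal_coe_nnreal,
        ← ENNReal.ofReal_mul (apply_nonneg _ _), ENNReal.ofReal_le_ofReal_iff (by positivity)] at h1
      refine h1.trans ?_
      rw [mul_comm, mul_assoc]
      exact mul_le_mul_of_nonneg_left (hC' θ) C.2)
  refine ⟨h, fun θ x => ?_⟩
  have e1 : reflectAt 0 (reflectAt x θ) = translate (-x) θ := by
    ext y
    simp only [reflectAt_apply, SchwartzMap.compSubConstCLM_apply]
    congr 1; abel
  have e2 : smoothing h θ x =
      ∫ z, convIntegrand B u f a (schwartzConv c b) (translate (-x) θ) 0 z := by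
    rw [← e1]; rfl
  have hinv : (volume : Measure (Rd d × Rd d)).IsAddRightInvariant := by
    rw [Measure.volume_eq_prod]; infer_instance
  -- The functional is defined by its value at x = 0; translating y by x gives the formula at every
  -- x.
  rw [e2, ← integral_add_right_eq_self (convIntegrand B u f a (schwartzConv c b) θ x) (0, x)]
  refine integral_congr_ae (.of_forall fun z => ?_)
  simp only [convIntegrand, Prod.fst_add, Prod.snd_add, add_zero]
  rw [schwartzConv_comm (translate (-x) θ), ← translate_schwartzConv, smoothing_translate,
    schwartzConv_comm _ θ, sub_neg_eq_add, zero_sub, sub_add_cancel_right]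

end Existence

/-! ### The convolution of u and f, and its modulation norm. -/

section Multiplier

variable {d : ℕ} {E₀ E₁ E₂ : Type*}
  [NormedAddCommGroup E₀] [NormedSpace ℂ E₀]
  [NormedAddCommGroup E₁] [NormedSpace ℂ E₁]
  [NormedAddCommGroup E₂] [NormedSpace ℂ E₂]
  {B : E₀ →L[ℂ] E₁ →L[ℂ] E₂} {u : 𝓢'(Rd d, E₀)} {f : 𝓢'(Rd d, E₁)} {r s δ : ℝ}

lemma schwartzConv_modulate_schwartzConv (φ ρ a : 𝓢(Rd d, ℂ)) (ξ : Rd d) :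
    schwartzConv φ (modulate ξ (schwartzConv ρ a)) =
      schwartzConv (modulate ξ a) (schwartzConv φ (modulate ξ ρ)) := by
  rw [modulate_schwartzConv, ← schwartzConv_assoc, schwartzConv_comm]

/-- As for f, the window ρ * a splits: u * M_ξ a is integrable with polynomial growth in ξ and φ *
M_ξ ρ decays rapidly. The resulting integrability in ξ serves the final exchange of integrals in
`exists_isConvolution`. -/
lemma SmoothingsIntegrable.exists_lintegral_le [CompleteSpace E₀]
    (hu : SmoothingsIntegrable r δ u) (φ ρ a : 𝓢(Rd d, ℂ)) :
    ∃ C : ℝ≥0, ∀ ξ, ∫⁻ y, weight |r| y *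
      ‖smoothing u (schwartzConv φ (modulate ξ (schwartzConv ρ a))) y‖ₑ ≤
        C * weight (-(d + 1 : ℝ)) ξ := by
  obtain ⟨M, hM⟩ := exists_nat_gt (d + 1 + |r| + |δ|)
  obtain ⟨q, -, hq⟩ := exists_enorm_schwartzConv_modulate_le ρ M
  obtain ⟨C, hC⟩ := hu a
  have hp : peetreConst d |r| M < ∞ :=
    peetreConst_lt_top (by rw [abs_abs]; linarith [abs_nonneg δ])
  refine ⟨(q φ).toNNReal * (peetreConst d |r| M).toNNReal * C, fun ξ => ?_⟩
  have hle : ∀ y, ‖smoothing u (schwartzConv φ (modulate ξ (schwartzConv ρ a))) y‖ₑ ≤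
      (ENNReal.ofReal (q φ) * weight (-(M : ℝ)) ξ) *
        ∫⁻ w, amplitude u a (y - w) ξ * weight (-(M : ℝ)) w := by
    intro y
    rw [schwartzConv_modulate_schwartzConv]
    refine (enorm_smoothing_schwartzConv_le u _ _ y).trans ?_
    rw [← lintegral_const_mul' _ _ (ENNReal.mul_ne_top ENNReal.ofReal_ne_top (weight_ne_top _ _))]
    refine lintegral_mono fun w => ?_
    calc _ ≤ (ENNReal.ofReal (q φ) * (weight (-(M : ℝ)) w * weight (-(M : ℝ)) ξ)) *
          amplitude u a (y - w) ξ := mul_le_mul' (hq φ ξ w) le_rfl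
      _ = _ := by ring
  have hy := eLpNorm_weight_mul_lintegral_le (r := |r|) (M := M) le_rfl
    (measurable_amplitude_slice u a ξ)
  simp only [eLpNorm_one_eq_lintegral_enorm, enorm_eq_self] at hy
  calc _ ≤ ∫⁻ y, (ENNReal.ofReal (q φ) * weight (-(M : ℝ)) ξ) * (weight |r| y *
        ∫⁻ w, amplitude u a (y - w) ξ * weight (-(M : ℝ)) w) := by
        refine lintegral_mono fun y => ?_
        rw [mul_left_comm]
        exact mul_le_mul' le_rfl (hle y)
    _ = (ENNReal.ofReal (q φ) * weight (-(M : ℝ)) ξ) * ∫⁻ y, weight |r| y *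
        ∫⁻ w, amplitude u a (y - w) ξ * weight (-(M : ℝ)) w :=
        lintegral_const_mul' _ _ (ENNReal.mul_ne_top ENNReal.ofReal_ne_top (weight_ne_top _ _))
    _ ≤ (ENNReal.ofReal (q φ) * weight (-(M : ℝ)) ξ) *
        (peetreConst d |r| M * (C * weight (-δ) ξ)) :=
        mul_le_mul' le_rfl (hy.trans (mul_le_mul' le_rfl (hC ξ)))
    _ = ENNReal.ofReal (q φ) * peetreConst d |r| M * C *
        (weight (-(M : ℝ)) ξ * weight (-δ) ξ) := by ring
    _ ≤ ENNReal.ofReal (q φ) * peetreConst d |r| M * C * weight (-(d + 1 : ℝ)) ξ := by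
        refine mul_le_mul' le_rfl ?_
        rw [← weight_add]
        exact weight_le_weight (by linarith [neg_abs_le δ, abs_nonneg r]) ξ
    _ = _ := by
        rw [ENNReal.coe_mul, ENNReal.coe_mul, ENNReal.coe_toNNReal hp.ne]
        rfl

lemma integrable_bilin_smoothing_modulate [CompleteSpace E₀] (hB : ‖B‖ ≤ 1)
    (hu : SmoothingsIntegrable r δ u) (hf : SmoothingsBounded r s f) (φ ψ ρ a : 𝓢(Rd d, ℂ))
    (x : Rd d) :
    Integrable (Function.uncurry fun ξ y : Rd d =>
      B (smoothing u (schwartzConv φ (modulate ξ (schwartzConv ρ a))) (x - y)) (smoothing f ψ y))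
      (volume.prod volume) := by
  have hm : StronglyMeasurable (Function.uncurry fun ξ y : Rd d =>
      B (smoothing u (schwartzConv φ (modulate ξ (schwartzConv ρ a))) (x - y))
        (smoothing f ψ y)) := by
    refine stronglyMeasurable_uncurry_of_continuous_of_stronglyMeasurable (fun y => ?_)
      fun ξ => (continuous_bilin_smoothing x _ ψ).stronglyMeasurable
    exact ((B.flip (smoothing f ψ y)) ∘L smoothingCLM u (x - y)).continuous.comp
      ((continuous_schwartzConv_right φ).comp (continuous_modulate _))
  refine ⟨hm.aestronglyMeasurable, ?_⟩
  obtain ⟨C, hC⟩ := hf.exists_le ψ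
  obtain ⟨C', hC'⟩ := hu.exists_lintegral_le φ ρ a
  have hI : ∫⁻ ξ : Rd d, weight (-(d + 1 : ℝ)) ξ < ∞ := lintegral_weight_lt_top (by linarith)
  rw [HasFiniteIntegral, lintegral_prod _ hm.enorm.aemeasurable]
  have hin : ∀ ξ : Rd d, ∫⁻ y, ‖B (smoothing u
      (schwartzConv φ (modulate ξ (schwartzConv ρ a))) (x - y)) (smoothing f ψ y)‖ₑ ≤
      (C * (ENNReal.ofReal (2 ^ |r|) * weight (-r) x) * C') * weight (-(d + 1 : ℝ)) ξ := by
    intro ξ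
    set φ' := schwartzConv φ (modulate ξ (schwartzConv ρ a)) with hφ'
    calc _ ≤ ∫⁻ y, C * (‖smoothing u φ' (x - y)‖ₑ * weight (-r) y) := by
          refine lintegral_mono fun y => (enorm_bilin_le hB _ _).trans ?_
          calc _ ≤ ‖smoothing u φ' (x - y)‖ₑ * (C * weight (-r) y) := mul_le_mul' le_rfl (hC y)
            _ = _ := by ring
      _ = C * ∫⁻ y, ‖smoothing u φ' (x - y)‖ₑ * weight (-r) y :=
          lintegral_const_mul' _ _ ENNReal.coe_ne_top
      _ ≤ C * (ENNReal.ofReal (2 ^ |r|) * weight (-r) x * (C' * weight (-(d + 1 : ℝ)) ξ)) :=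
          mul_le_mul' le_rfl ((lintegral_mul_weight_neg_le (fun y => ‖smoothing u φ' y‖ₑ) r x).trans
            (mul_le_mul' le_rfl (hC' ξ)))
      _ = _ := by ring
  refine (lintegral_mono hin).trans_lt ?_
  rw [lintegral_const_mul _ (measurable_weight _)]
  exact ENNReal.mul_lt_top (ENNReal.mul_lt_top (ENNReal.mul_lt_top ENNReal.coe_lt_top
    (ENNReal.mul_lt_top ENNReal.ofReal_lt_top (weight_ne_top _ _).lt_top)) ENNReal.coe_lt_top) hI

theorem exists_isConvolution [CompleteSpace E₀] [CompleteSpace E₁] [CompleteSpace E₂]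
    (hB : ‖B‖ ≤ 1) (hu : SmoothingsIntegrable r δ u) (hf : SmoothingsBounded r s f)
    {γ : 𝓢(Rd d, ℂ)} (hγ : γ ≠ 0) : ∃ h : 𝓢'(Rd d, E₂), IsConvolution B u f h := by
  -- The construction requires ρ to be a convolution, whereas a is chosen such that κ = ρ * a has
  -- κ(0) = ‖ρ‖₂² ≠ 0.
  set ρ := schwartzConv γ (involution γ) with hρ
  have hρ0 : ρ ≠ 0 := fun h => schwartzConv_involution_zero_ne_zero hγ (by rw [← hρ, h]; rfl)
  set a := involution ρ
  set κ := schwartzConv ρ a with hκ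
  have hκ0 : κ 0 ≠ 0 := schwartzConv_involution_zero_ne_zero hρ0
  obtain ⟨h, hh⟩ := exists_distribution hB hu hf a (involution γ) γ
  rw [← hρ] at hh
  refine ⟨(κ 0)⁻¹ • h, fun φ ψ x => ⟨integrable_bilin_smoothing hB hu hf x φ ψ, ?_⟩⟩
  have e : smoothing ((κ 0)⁻¹ • h) (schwartzConv φ ψ) x =
      (κ 0)⁻¹ • smoothing h (schwartzConv φ ψ) x := rfl
  rw [e, hh, eq_inv_smul_iff₀ hκ0]
  have hΦint : Integrable (convIntegrand B u f a ρ (schwartzConv φ ψ) x) (volume.prod volume) := by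
    rw [← Measure.volume_eq_prod]
    exact integrable_convIntegrand hB hu hf a (involution γ) γ _ x
  rw [Measure.volume_eq_prod, integral_prod _ hΦint]
  -- The test function φ * M_ξ ρ is moved from f to u, where it joins M_ξ a to form φ * M_ξ κ.
  have h1 : ∀ ξ, ∫ y, convIntegrand B u f a ρ (schwartzConv φ ψ) x (ξ, y) =
      ∫ y, B (smoothing u (schwartzConv φ (modulate ξ κ)) (x - y)) (smoothing f ψ y) := fun ξ => by
    have h2 := integral_bilin_smoothing_comm hB hu hf x (modulate ξ a) ψ
      (schwartzConv φ (modulate ξ ρ))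
    rw [← schwartzConv_modulate_schwartzConv, ← schwartzConv_assoc, schwartzConv_comm ψ φ] at h2
    exact h2
  simp only [h1]
  rw [integral_integral_swap (integrable_bilin_smoothing_modulate hB hu hf φ ψ ρ a x),
    ← integral_smul]
  refine integral_congr_ae (.of_forall fun y => ?_)
  -- For fixed y the integral over ξ is the reproducing formula, applied to φ ↦ B((u * φ)(x - y), (f
  -- * ψ)(y)).
  exact smul_map_eq_integral_modulate ((B.flip (smoothing f ψ y)) ∘L smoothingCLM u (x - y)) φ κ

/-- The convolution estimate for modulation norms. -/
theorem IsConvolution.mixedNorm_le {h : 𝓢'(Rd d, E₂)} (hB : ‖B‖ ≤ 1) (hh : IsConvolution B u f h)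
    (φ ψ : 𝓢(Rd d, ℂ)) {p q : ℝ≥0∞} (hp : 1 ≤ p) :
    mixedNorm p q r (s + δ) (amplitude h (schwartzConv φ ψ)) ≤ ENNReal.ofReal (2 ^ |r|) *
      mixedNorm 1 ∞ |r| δ (amplitude u φ) * mixedNorm p q r s (amplitude f ψ) := by
  have hx : ∀ x ξ, weight r x * amplitude h (schwartzConv φ ψ) x ξ ≤ ENNReal.ofReal (2 ^ |r|) *
      ∫⁻ z, (weight r (x - z) * amplitude f ψ (x - z) ξ) * (weight |r| z * amplitude u φ z ξ) := by
    intro x ξ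
    -- The defining identity of the convolution is used with the modulated test functions M_ξ φ and
    -- M_ξ ψ, so the frequency is the same on both sides.
    have h1 : amplitude h (schwartzConv φ ψ) x ξ ≤
        ∫⁻ z, amplitude u φ z ξ * amplitude f ψ (x - z) ξ := by
      rw [amplitude, modulate_schwartzConv, ← (hh (modulate ξ φ) (modulate ξ ψ) x).2]
      refine (enorm_integral_le_lintegral_enorm _).trans ?_
      rw [← lintegral_sub_left_eq_self _ x]
      refine lintegral_mono fun z => ?_
      rw [sub_sub_cancel]
      exact enorm_bilin_le hB _ _
    refine (mul_le_mul' le_rfl h1).trans ?_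
    rw [← lintegral_const_mul' _ _ (weight_ne_top _ _),
      ← lintegral_const_mul' _ _ ENNReal.ofReal_ne_top]
    refine lintegral_mono fun z => ?_
    have h2 := weight_add_arg_le r (x - z) z
    rw [sub_add_cancel] at h2
    calc _ ≤ (ENNReal.ofReal (2 ^ |r|) * (weight r (x - z) * weight |r| z)) *
          (amplitude u φ z ξ * amplitude f ψ (x - z) ξ) := mul_le_mul' h2 le_rfl
      _ = _ := by ring
  have hF : ∀ ξ, Measurable fun x => weight r x * amplitude f ψ x ξ := fun ξ =>
    (measurable_weight r).mul (measurable_amplitude_slice f ψ ξ)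
  have hU : ∀ ξ, Measurable fun x => weight |r| x * amplitude u φ x ξ := fun ξ =>
    (measurable_weight _).mul (measurable_amplitude_slice u φ ξ)
  have hslice : ∀ ξ, eLpNorm (fun x => weight r x * amplitude h (schwartzConv φ ψ) x ξ) p volume ≤
      ENNReal.ofReal (2 ^ |r|) * (eLpNorm (fun x => weight r x * amplitude f ψ x ξ) p volume *
        eLpNorm (fun x => weight |r| x * amplitude u φ x ξ) 1 volume) := by
    intro ξ
    have hm : Measurable fun x => ∫⁻ z, (weight r (x - z) * amplitude f ψ (x - z) ξ) *
        (weight |r| z * amplitude u φ z ξ) := by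
      refine Measurable.lintegral_prod_right' (f := fun z : Rd d × Rd d =>
        (weight r (z.1 - z.2) * amplitude f ψ (z.1 - z.2) ξ) *
          (weight |r| z.2 * amplitude u φ z.2 ξ)) ?_
      exact ((hF ξ).comp (measurable_fst.sub measurable_snd)).mul ((hU ξ).comp measurable_snd)
    calc _ ≤ eLpNorm (fun x => ENNReal.ofReal (2 ^ |r|) *
          ∫⁻ z, (weight r (x - z) * amplitude f ψ (x - z) ξ) *
            (weight |r| z * amplitude u φ z ξ)) p volume :=
          eLpNorm_mono_enorm fun x => hx x ξ
      _ ≤ ENNReal.ofReal (2 ^ |r|) * eLpNorm (fun x =>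
          ∫⁻ z, (weight r (x - z) * amplitude f ψ (x - z) ξ) *
            (weight |r| z * amplitude u φ z ξ)) p volume := eLpNorm_const_mul_ennreal _ hm p
      _ ≤ _ := by
          refine mul_le_mul' le_rfl ((eLpNorm_lconvolution_le (hF ξ) (hU ξ) hp).trans_eq ?_)
          simp only [eLpNorm_one_eq_lintegral_enorm, enorm_eq_self]
  -- The L^∞ norm in frequency only bounds almost every slice, which suffices inside the L^q norm.
  have hsup : ∀ᵐ ξ, eLpNorm (fun x => weight |r| x * amplitude u φ x ξ) 1 volume * weight δ ξ ≤
      mixedNorm 1 ∞ |r| δ (amplitude u φ) := by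
    have := ENNReal.ae_le_essSup (μ := (volume : Measure (Rd d)))
      (fun ξ => eLpNorm (fun x => weight |r| x * amplitude u φ x ξ) 1 volume * weight δ ξ)
    simpa [mixedNorm, eLpNormEssSup] using this
  have hmf : Measurable fun ξ => eLpNorm (fun x => weight r x * amplitude f ψ x ξ) p volume *
      weight s ξ :=
    (measurable_eLpNorm_right (measurable_weight_mul (measurable_amplitude f ψ) r) p).mul
      (measurable_weight s)
  calc _ ≤ eLpNorm (fun ξ => (ENNReal.ofReal (2 ^ |r|) * mixedNorm 1 ∞ |r| δ (amplitude u φ)) *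
        (eLpNorm (fun x => weight r x * amplitude f ψ x ξ) p volume * weight s ξ)) q volume := by
        refine eLpNorm_mono_enorm_ae ?_
        filter_upwards [hsup] with ξ hξ
        simp only [enorm_eq_self]
        calc _ ≤ (ENNReal.ofReal (2 ^ |r|) *
              (eLpNorm (fun x => weight r x * amplitude f ψ x ξ) p volume *
              eLpNorm (fun x => weight |r| x * amplitude u φ x ξ) 1 volume)) *
                weight (s + δ) ξ := mul_le_mul' (hslice ξ) le_rfl
          _ = (ENNReal.ofReal (2 ^ |r|) *
              (eLpNorm (fun x => weight |r| x * amplitude u φ x ξ) 1 volume * weight δ ξ)) *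
              (eLpNorm (fun x => weight r x * amplitude f ψ x ξ) p volume * weight s ξ) := by
              rw [weight_add]; ring
          _ ≤ _ := mul_le_mul' (mul_le_mul' le_rfl hξ) le_rfl
    _ ≤ _ := eLpNorm_const_mul_ennreal _ hmf q

lemma smoothingsIntegrable_of_mixedNorm_lt_top [CompleteSpace E₀] {γ : 𝓢(Rd d, ℂ)} (hγ : γ ≠ 0)
    (h : mixedNorm 1 ∞ |r| δ (amplitude u γ) < ∞) : SmoothingsIntegrable r δ u := by
  intro φ
  obtain ⟨C, hC⟩ := exists_slice_le hγ φ le_rfl le_top |r| δ h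
  refine ⟨C, fun η => ?_⟩
  have := hC η
  simpa only [eLpNorm_one_eq_lintegral_enorm, enorm_eq_self] using this

end Multiplier

end TimeFrequency

end

theorem mainTheorem10 (d : ℕ) (p q : ℝ≥0∞) (hp : 1 ≤ p) (hq : 1 ≤ q) (r s δ : ℝ)
    (g₀ g₁ g₂ : 𝓢(Rd d, ℂ)) (hg₀ : g₀ ≠ 0) (hg₁ : g₁ ≠ 0) (hg₂ : g₂ ≠ 0) :
    ∃ C : ℝ≥0,
      ∀ (E₀ : Type u₀) [NormedAddCommGroup E₀] [NormedSpace ℂ E₀] [CompleteSpace E₀]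
        (E₁ : Type u₁) [NormedAddCommGroup E₁] [NormedSpace ℂ E₁] [CompleteSpace E₁]
        (E₂ : Type u₂) [NormedAddCommGroup E₂] [NormedSpace ℂ E₂] [CompleteSpace E₂]
        (B : E₀ →L[ℂ] E₁ →L[ℂ] E₂) (_ : ‖B‖ ≤ 1)
        (μ : 𝓢'(Rd d, E₀)) (_ : MemAmalgam 1 ∞ |r| δ μ)
        (f : 𝓢'(Rd d, E₁)) (_ : MemModulation p q r s f),
        ∃ hf : f ∈ (fourierMultiplier B μ).domain,
          MemModulation p q r (s + δ) (fourierMultiplier B μ ⟨f, hf⟩) ∧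
          modulationNorm g₂ p q r (s + δ) (fourierMultiplier B μ ⟨f, hf⟩) ≤
            C * amalgamNorm g₀ 1 ∞ |r| δ μ * modulationNorm g₁ p q r s f := by
  have hγ₀ := dualWindow_ne_zero hg₀
  have hγ₁ := involution_ne_zero hg₁
  set γ := involution g₁ with hγ
  set κ := schwartzConv γ (involution γ) with hκ
  have hκ0 : κ ≠ 0 := fun h => schwartzConv_involution_zero_ne_zero hγ₁ (by rw [← hκ, h]; rfl)
  -- The convolution estimate is used with the test functions γ and γ~, which produces the window κ
  -- for the result. `C₀`, `C₁`, `C₂` translate to the prescribed windows of μ, f and μ(D)f.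
  obtain ⟨C₀, hC₀⟩ := exists_mixedNorm_amplitude_le hγ₀ γ le_rfl le_top |r| δ
  obtain ⟨C₁, hC₁⟩ := exists_mixedNorm_amplitude_le hγ₁ (involution γ) hp hq r s
  obtain ⟨C₂, hC₂⟩ := exists_mixedNorm_amplitude_le hκ0 (involution g₂) hp hq r (s + δ)
  refine ⟨C₂ * ((2 : ℝ) ^ |r|).toNNReal * C₀ * C₁, ?_⟩
  intro E₀ _ _ _ E₁ _ _ _ E₂ _ _ _ B hB μ hμ f hf
  -- Membership is witnessed by windows unrelated to `g₀` and `g₁`; they serve existence and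
  -- finiteness only and do not enter the constant.
  obtain ⟨g₀', hg₀', hμ⟩ := hμ
  obtain ⟨g₁', hg₁', hf⟩ := hf
  rw [amalgamNorm_eq] at hμ
  rw [modulationNorm_eq] at hf
  have hu' := smoothingsIntegrable_of_mixedNorm_lt_top (dualWindow_ne_zero hg₀') hμ
  have hf' : SmoothingsBounded r s f := fun ψ =>
    exists_pointwise_le (involution_ne_zero hg₁') ψ hp hq r s hf
  obtain ⟨h, hh⟩ := exists_isConvolution hB hu' hf' hγ₁
  have hgraph := mem_fourierMultiplier_graph_iff.2 hh
  have hdom := LinearPMap.mem_domain_of_mem_graph hgraph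
  have hval : fourierMultiplier B μ ⟨f, hdom⟩ = h :=
    LinearPMap.mem_graph_snd_inj _ ((fourierMultiplier B μ).mem_graph ⟨f, hdom⟩) hgraph rfl
  have key : modulationNorm g₂ p q r (s + δ) h ≤
      (C₂ * ((2 : ℝ) ^ |r|).toNNReal * C₀ * C₁ : ℝ≥0) * amalgamNorm g₀ 1 ∞ |r| δ μ *
        modulationNorm g₁ p q r s f := by
    rw [modulationNorm_eq, modulationNorm_eq, amalgamNorm_eq, ← hγ]
    refine (hC₂ E₂ h).trans ((mul_le_mul' le_rfl ((hh.mixedNorm_le hB γ (involution γ) hp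
      (r := r) (s := s) (δ := δ)).trans (mul_le_mul' (mul_le_mul' le_rfl (hC₀ E₀ (𝓕⁻ μ)))
        (hC₁ E₁ f)))).trans_eq ?_)
    rw [ENNReal.coe_mul, ENNReal.coe_mul, ENNReal.coe_mul, ENNReal.ofReal]
    ring
  refine ⟨hdom, ?_, ?_⟩
  · rw [hval]
    refine ⟨g₂, hg₂, key.trans_lt ?_⟩
    -- `D₀` and `D₁` transfer finiteness from the witnessing windows to `g₀` and `g₁`.
    obtain ⟨D₀, hD₀⟩ := exists_mixedNorm_amplitude_le (dualWindow_ne_zero hg₀') (dualWindow g₀)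
      le_rfl le_top |r| δ
    obtain ⟨D₁, hD₁⟩ := exists_mixedNorm_amplitude_le (involution_ne_zero hg₁') (involution g₁)
      hp hq r s
    have h₀ : amalgamNorm g₀ 1 ∞ |r| δ μ < ∞ := by
      rw [amalgamNorm_eq]
      exact (hD₀ E₀ (𝓕⁻ μ)).trans_lt (ENNReal.mul_lt_top ENNReal.coe_lt_top hμ)
    have h₁ : modulationNorm g₁ p q r s f < ∞ := by
      rw [modulationNorm_eq]
      exact (hD₁ E₁ f).trans_lt (ENNReal.mul_lt_top ENNReal.coe_lt_top hf)
    exact ENNReal.mul_lt_top (ENNReal.mul_lt_top ENNReal.coe_lt_top h₀) h₁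
  · rw [hval]
    exact key
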